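/- Call a set $P\subseteq\mathbb R^2$ a \emph{connected polygon} if it is a finite union of closed convex polygonal regions (intersections of finitely many closed half-planes), it is the closure of its interior, and its interior is nonempty and connected; $P$ may have holes and may be unbounded. For $C,D\subseteq\mathbb R^2$, a \emph{crossing} of $\partial C$ with $\partial D$ is a connected component $K$ of $\partial C\cap\partial D$ such that every neighbourhood of $K$ contains points of $\partial C$ lying in the interior of $D$ and points of $\partial C$ lying outside the closure of $D$. (i) Let $P$ and $P'$ be two connected polygons in the plane with disjoint interiors, and let $C$ and $C'$ be their convex hulls. Then $\partial C$ and $\partial C'$ cross each other at most twice. (ii) Let $P_1,\dots,P_m$ be connected polygons in the plane with pairwise disjoint interiors, and let $C_i$ be the convex hull of $P_i$. Then $C_1,\dots,C_m$ is a family of convex pseudo-disks, that is: each $C_i$ is convex and simply connected, and for all $i\ne j$ the boundaries $\partial C_i$ and $\partial C_j$ cross at most twice, they have at most two common points if they have only finitely many, and $C_i\setminus C_j$ and $C_j\setminus C_i$ are both connected (possibly empty). -/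

import Mathlib

/-- The Euclidean plane. -/
abbrev Plane : Type := EuclideanSpace ℝ (Fin 2)

/-- A closed half-plane `{x | ⟪a, x⟫ ≤ b}` with `a ≠ 0`. -/
def IsClosedHalfPlane (H : Set Plane) : Prop :=
  ∃ (a : Plane) (b : ℝ), a ≠ 0 ∧ H = {x : Plane | inner ℝ a x ≤ b}

/-- A closed convex polygonal region, possibly unbounded: an intersection of finitely many
closed half-planes (the empty intersection is the whole plane). -/
def IsConvexPolygonalRegion (Q : Set Plane) : Prop :=
  ∃ F : Set (Set Plane), F.Finite ∧ (∀ H ∈ F, IsClosedHalfPlane H) ∧ Q = ⋂₀ F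

/-- A connected polygon: a finite union of closed convex polygonal regions that is the closure of
its interior (no dangling segments or isolated points) and whose interior is nonempty and
connected. It may have holes, and it may be unbounded. -/
structure IsConnectedPolygon (P : Set Plane) : Prop where
  polygonal : ∃ F : Set (Set Plane),
    F.Finite ∧ (∀ Q ∈ F, IsConvexPolygonalRegion Q) ∧ P = ⋃₀ F
  regular : closure (interior P) = P
  connected : IsConnected (interior P)

/-- The crossings of the boundary of `C` with the boundary of `D`: the connected components `K` of
the intersection of the two boundaries (single points, or arcs along which the boundaries overlap)
at which the boundary of `C` passes from the inside of `D` to the outside of `D`, that is, such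
that every neighbourhood of `K` contains points of the boundary of `C` of both kinds. -/
def boundaryCrossings (C D : Set Plane) : Set (Set Plane) :=
  {K | (∃ x ∈ frontier C ∩ frontier D,
          K = connectedComponentIn (frontier C ∩ frontier D) x) ∧
        ∀ U : Set Plane, IsOpen U → K ⊆ U →
          (U ∩ (frontier C ∩ interior D)).Nonempty ∧
          (U ∩ (frontier C \ closure D)).Nonempty}

/-- A family of convex pseudo-disks. The members are convex and simply connected; for any two of
them the boundaries cross at most twice, the boundaries meet in at most two points if they meet in
finitely many points (that is, if they do not overlap), and both set differences are connected
(possibly empty). The last condition is the definition of pseudo-disks that is used when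
boundaries may overlap. -/
structure IsConvexPseudoDiskFamily {ι : Type} (C : ι → Set Plane) : Prop where
  convex : ∀ i, Convex ℝ (C i)
  simplyConnected : ∀ i, SimplyConnectedSpace (C i)
  crossings : ∀ i j, i ≠ j → (boundaryCrossings (C i) (C j)).encard ≤ 2
  intersections : ∀ i j, i ≠ j → (frontier (C i) ∩ frontier (C j)).Finite →
    (frontier (C i) ∩ frontier (C j)).encard ≤ 2
  differences : ∀ i j, i ≠ j → IsPreconnected (C i \ C j)

open Set

/-! Let `U`, `V` be the interiors of two of the polygons, and let `A`, `B` be the convex hulls of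
`U` and `V`. These are open, and they have the same closures and boundaries as the hulls of the
polygons themselves. The latter need not be closed, because polygons may be unbounded.

Everything rests on one planar fact, `disjoint_segment_of_disjoint_paths`: two disjoint paths,
neither of which has an endpoint in the hull of the other, do not have crossing chords. The
difference of the two paths is a nonvanishing function on a square, so it has a continuous logarithm
and its total turning along the boundary of the square is zero. If the chords crossed, the
differences would turn in the same sense along all four sides.

For a chord `bd` of `A` with ends off the closure of `B`, take a path from `b` to `d` in `A \ V` and
let `K` be its hull, a compact subset of `A`. A point of `B` outside `K` can be joined to `V`
outside `K`, so by the planar fact no chord between two such points crosses `bd`. Hence, if `bd`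
meets the closure of `B`, all of `B` on one side of the line `bd` lies in `K`
(`exists_blocking_side`). The three claims follow from this.

Differences: `b` and `d` are connected in `A` by walking around the part of the closure of `B`
inside `K`. Passing from open hulls to the actual hulls needs an analysis of boundary points, where
a hull that is not closed is the only danger.

Crossings: chords of `A \ closure B` and of `B \ closure A` are disjoint, so the hulls of these two
sets are disjoint and a line separates them. Every crossing meets this line, and a line through a
point of an open convex set has at most two points of its boundary.

Finite intersections: three collinear common boundary points force a common boundary segment. Given
a triangle of them, beyond each edge one of the sets must leave the closure of the other. By the
pigeonhole principle the same set does so across two edges, and the blocking argument excludes this.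
-/

/-! ### Winding numbers and crossing chords -/

/-- A continuous logarithm of `γ s - δ t` on the plane of parameters, for disjoint paths. -/
theorem exists_continuous_log_sub {a b c d : ℂ} (γ : Path b d) (δ : Path a c)
    (h : ∀ s t, γ s ≠ δ t) :
    ∃ L : ℝ × ℝ → ℂ, Continuous L ∧
      ∀ s t, Complex.exp (L (s, t)) = γ.extend s - δ.extend t := by
  let F : C(ℝ × ℝ, ℂ) := ⟨fun p => γ.extend p.1 - δ.extend p.2, by fun_prop⟩
  have hF : ∀ p, F p ≠ 0 := by
    intro p hp
    exact h _ _ (sub_eq_zero.1 hp)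
  have hne : F (0, 0) ≠ 0 := hF _
  obtain ⟨L, hL, -⟩ := Complex.isCoveringMapOn_exp.existsUnique_continuousMap_lifts F
    (a₀ := (0, 0)) (e₀ := Complex.log (F (0, 0))) (by simp [Complex.exp_log hne])
    (fun p => by simpa using hF p)
  refine ⟨L, L.continuous, fun s t => ?_⟩
  exact congrFun hL.2 (s, t)

/-- As long as the quotient avoids the negative real axis, the principal logarithm is a continuous
lift through `exp`; two lifts that agree at `s₀` agree everywhere. -/
theorem log_div_eq_sub {L g : ℝ → ℂ} (hL : Continuous L) (hg : ∀ s, Complex.exp (L s) = g s)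
    {s₀ s₁ : ℝ} (h : ∀ s, g s / g s₀ ∈ Complex.slitPlane) :
    L s₁ - L s₀ = Complex.log (g s₁ / g s₀) := by
  have hgc : Continuous g := by
    have : g = fun s => Complex.exp (L s) := funext fun s => (hg s).symm
    rw [this]; fun_prop
  have hlog : Continuous fun s => Complex.log (g s / g s₀) :=
    (hgc.div_const _).clog h
  have key : ∀ s, Complex.exp (L s - L s₀) = Complex.exp (Complex.log (g s / g s₀)) := by
    intro s
    rw [Complex.exp_sub, hg, hg, Complex.exp_log (Complex.slitPlane_ne_zero (h s))]
  have := Complex.isCoveringMap_exp.eq_of_comp_eq (g₁ := fun s => L s - L s₀)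
    (g₂ := fun s => Complex.log (g s / g s₀)) (hL.sub continuous_const) hlog
    (by funext s; simpa using key s) s₀
    (by
      have : g s₀ ≠ 0 := by rw [← hg]; exact Complex.exp_ne_zero _
      simp [div_self this])
  exact congrFun this s₁

/-- A quotient that is a nonpositive real would put `p` between `x` and `y`. This turns the segment
hypotheses on the paths into the slit-plane hypothesis of `log_div_eq_sub`. -/
theorem div_mem_slitPlane_of_notMem_segment {p x y : ℂ} (h : p ∉ segment ℝ x y) :
    (y - p) / (x - p) ∈ Complex.slitPlane := by
  by_contra hs
  have hx : x - p ≠ 0 := fun h0 => h (by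
    rw [← sub_eq_zero.1 h0]; exact left_mem_segment ℝ x y)
  rw [Complex.mem_slitPlane_iff, not_or, not_lt, not_not] at hs
  obtain ⟨h1, h2⟩ := hs
  set q := (y - p) / (x - p) with hq
  have hqr : q = (q.re : ℂ) := by apply Complex.ext <;> simp [h2]
  have hy : y - p = (q.re : ℂ) * (x - p) := by rw [← hqr, hq, div_mul_cancel₀ _ hx]
  set r := q.re
  have hr : (0 : ℝ) < 1 - r := by linarith
  refine h ⟨-r / (1 - r), 1 / (1 - r), by apply div_nonneg <;> linarith, by positivity, by
    field_simp; ring, ?_⟩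
  have hc : (1 - (r : ℂ)) ≠ 0 := by exact_mod_cast hr.ne'
  have : y = p + (r : ℂ) * (x - p) := by rw [← hy]; ring
  rw [this]
  simp only [Complex.real_smul]
  push_cast
  field_simp
  ring

theorem im_div_eq (z w : ℂ) :
    (z / w).im = (w.re * z.im - w.im * z.re) / Complex.normSq w := by
  rw [Complex.div_im]; ring

theorem arg_div_pos {z w : ℂ} (h : 0 < w.re * z.im - w.im * z.re) : 0 < (z / w).arg := by
  have hw : 0 < Complex.normSq w := by
    rw [Complex.normSq_pos]; rintro rfl; simp at h
  have him : 0 < (z / w).im := by rw [im_div_eq]; positivity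
  refine lt_of_le_of_ne (Complex.arg_nonneg_iff.2 him.le) fun h0 => ?_
  have := (Complex.arg_eq_zero_iff.1 h0.symm).2
  exact him.ne' this

theorem arg_div_neg {z w : ℂ} (h : w.re * z.im - w.im * z.re < 0) : (z / w).arg < 0 := by
  have hw : 0 < Complex.normSq w := by
    rw [Complex.normSq_pos]; rintro rfl; simp at h
  rw [Complex.arg_neg_iff, im_div_eq]
  exact div_neg_of_neg_of_pos h hw

/-- Segments on a common line that meet have an endpoint on the other one. -/
theorem Complex.cross_ne_zero_of_segments_meet {a b c d w : ℂ} (hbd : w ∈ segment ℝ b d)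
    (hac : w ∈ segment ℝ a c) (ha : a ∉ segment ℝ b d)
    (hb : b ∉ segment ℝ a c) (hd : d ∉ segment ℝ a c) :
    (c - a).re * (d - b).im - (c - a).im * (d - b).re ≠ 0 := by
  intro h0
  rw [segment_eq_image'] at *
  obtain ⟨μ, ⟨hμ0, hμ1⟩, hμ⟩ := hbd
  obtain ⟨l, ⟨hl0, hl1⟩, hl⟩ := hac
  have hca : c - a ≠ 0 := by
    intro h
    refine ha ⟨μ, ⟨hμ0, hμ1⟩, ?_⟩
    rw [h] at hl; simp only [smul_zero, add_zero] at hl; rw [hl]; exact hμ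
  have him : ((d - b) / (c - a)).im = 0 := by rw [im_div_eq, h0, zero_div]
  obtain ⟨k, hk⟩ : ∃ k : ℝ, d - b = k • (c - a) := by
    refine ⟨((d - b) / (c - a)).re, ?_⟩
    have : (((d - b) / (c - a)).re : ℂ) = (d - b) / (c - a) := by
      apply Complex.ext <;> simp [him]
    rw [Complex.real_smul, this, div_mul_cancel₀ _ hca]
  -- In the coordinate of the common line with `a` at 0 and `c` at 1, the point `w` is at `l`, and
  -- `b`, `d` are at `l - μ * k`, `l + (1 - μ) * k`. Both lie outside `[0, 1]` on either side of
  -- `l`, so 0 is between them, contrary to `ha`.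
  have hbe : b = a + (l - μ * k) • (c - a) := by
    simp only at hμ hl
    rw [hk, smul_smul] at hμ
    rw [sub_smul]
    linear_combination (norm := module) hμ - hl
  have hde : d = a + (l + (1 - μ) * k) • (c - a) := by
    have : d = b + k • (c - a) := by rw [← hk]; ring
    rw [this]; nth_rw 1 [hbe]; module
  have hb' : ¬ (0 ≤ l - μ * k ∧ l - μ * k ≤ 1) := fun h => hb ⟨_, h, hbe.symm⟩
  have hd' : ¬ (0 ≤ l + (1 - μ) * k ∧ l + (1 - μ) * k ≤ 1) := fun h => hd ⟨_, h, hde.symm⟩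
  have ha' : ∀ τ : ℝ, 0 ≤ τ → τ ≤ 1 → l - μ * k + τ * k ≠ 0 := by
    intro τ h1 h2 h3
    refine ha ⟨τ, ⟨h1, h2⟩, ?_⟩
    simp only
    rw [hk]; nth_rw 1 [hbe]
    rw [add_assoc, smul_smul, ← add_smul, h3]; simp
  rcases lt_trichotomy k 0 with hk0 | hk0 | hk0
  · have h1 : l + (1 - μ) * k < 0 := by
      by_contra h
      exact hd' ⟨not_lt.1 h, by nlinarith⟩
    refine ha' (μ - l / k) ?_ ?_ (by rw [sub_mul, div_mul_cancel₀ _ hk0.ne]; ring)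
    · have : l / k ≤ 0 := div_nonpos_of_nonneg_of_nonpos hl0 hk0.le
      linarith
    · have : -(1 - μ) ≤ l / k := by
        rw [le_div_iff_of_neg hk0]; nlinarith
      linarith
  · rw [hk0] at hb'; simp only [mul_zero, sub_zero] at hb'; exact hb' ⟨hl0, hl1⟩
  · have h1 : l - μ * k < 0 := by
      by_contra h
      exact hb' ⟨not_lt.1 h, by nlinarith⟩
    refine ha' (μ - l / k) ?_ ?_ (by rw [sub_mul, div_mul_cancel₀ _ hk0.ne']; ring)
    · have : l / k ≤ μ := by
        rw [div_le_iff₀ hk0]; nlinarith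
      linarith
    · have : 0 ≤ l / k := by positivity
      linarith

/-- Disjoint paths whose endpoints are outside of each other's hulls do not have crossing
chords. -/
theorem Complex.disjoint_segment_of_disjoint_paths {a b c d : ℂ} (γ : Path b d) (δ : Path a c)
    (h : ∀ s t, γ s ≠ δ t) (ha : ∀ s, a ∉ segment ℝ b (γ s)) (hc : ∀ s, c ∉ segment ℝ b (γ s))
    (hb : ∀ t, b ∉ segment ℝ c (δ t)) (hd : ∀ t, d ∉ segment ℝ c (δ t)) :
    Disjoint (segment ℝ b d) (segment ℝ a c) := by
  rw [Set.disjoint_left]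
  intro w hw1 hw2
  have ha1 : a ∉ segment ℝ b d := by simpa using ha 1
  have hc1 : c ∉ segment ℝ b d := by simpa using hc 1
  have hb1 : b ∉ segment ℝ a c := by rw [segment_symm]; simpa using hb 0
  have hd1 : d ∉ segment ℝ a c := by rw [segment_symm]; simpa using hd 0
  have hΔ := Complex.cross_ne_zero_of_segments_meet hw1 hw2 ha1 hb1 hd1
  obtain ⟨L, hL, hexp⟩ := exists_continuous_log_sub γ δ h
  -- On each side of the parameter square one endpoint is fixed, so the change of `L` there is a
  -- principal logarithm.
  have e1 := log_div_eq_sub (L := fun s => L (s, 0)) (g := fun s => γ.extend s - a) (s₀ := 0)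
    (s₁ := 1) (by fun_prop) (fun s => by simpa using hexp s 0) (fun s => by
      simp only [Path.extend_zero]
      exact div_mem_slitPlane_of_notMem_segment (ha (Set.projIcc 0 1 zero_le_one s)))
  have e4 := log_div_eq_sub (L := fun s => L (s, 1)) (g := fun s => γ.extend s - c) (s₀ := 0)
    (s₁ := 1) (by fun_prop) (fun s => by simpa using hexp s 1) (fun s => by
      simp only [Path.extend_zero]
      exact div_mem_slitPlane_of_notMem_segment (hc (Set.projIcc 0 1 zero_le_one s)))
  have e2 := log_div_eq_sub (L := fun t => L (1, t)) (g := fun t => d - δ.extend t) (s₀ := 1)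
    (s₁ := 0) (by fun_prop) (fun s => by simpa using hexp 1 s) (fun s => by
      have := div_mem_slitPlane_of_notMem_segment (hd (Set.projIcc 0 1 zero_le_one s))
      rw [← neg_div_neg_eq, neg_sub, neg_sub] at this
      simp only [Path.extend_one]
      exact this)
  have e3 := log_div_eq_sub (L := fun t => L (0, t)) (g := fun t => b - δ.extend t) (s₀ := 1)
    (s₁ := 0) (by fun_prop) (fun s => by simpa using hexp 0 s) (fun s => by
      have := div_mem_slitPlane_of_notMem_segment (hb (Set.projIcc 0 1 zero_le_one s))
      rw [← neg_div_neg_eq, neg_sub, neg_sub] at this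
      simp only [Path.extend_one]
      exact this)
  simp only [Path.extend_zero, Path.extend_one] at e1 e2 e3 e4
  -- The changes of `L` along the four sides of the square add up to zero.
  have hsum : Complex.log ((d - c) / (b - c)) = Complex.log ((d - a) / (b - a))
      - Complex.log ((d - a) / (d - c)) + Complex.log ((b - a) / (b - c)) := by
    rw [← e1, ← e2, ← e3, ← e4]; ring
  have harg := congrArg Complex.im hsum
  simp only [Complex.add_im, Complex.sub_im, Complex.log_im] at harg
  rw [segment_eq_image'] at hw1 hw2
  obtain ⟨μ, ⟨hμ0, hμ1⟩, hμ⟩ := hw1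
  obtain ⟨l, ⟨hl0, hl1⟩, hl⟩ := hw2
  simp only at hμ hl
  have hμ0' : 0 < μ := lt_of_le_of_ne hμ0 fun h0 => hb1 (by
    rw [segment_eq_image']; exact ⟨l, ⟨hl0, hl1⟩, by simp only; rw [hl, ← hμ, ← h0]; simp⟩)
  have hμ1' : μ < 1 := lt_of_le_of_ne hμ1 fun h0 => hd1 (by
    rw [segment_eq_image']; exact ⟨l, ⟨hl0, hl1⟩, by simp only; rw [hl, ← hμ, h0]; simp⟩)
  have hl0' : 0 < l := lt_of_le_of_ne hl0 fun h0 => ha1 (by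
    rw [segment_eq_image']; exact ⟨μ, ⟨hμ0, hμ1⟩, by simp only; rw [hμ, ← hl, ← h0]; simp⟩)
  have hl1' : l < 1 := lt_of_le_of_ne hl1 fun h0 => hc1 (by
    rw [segment_eq_image']; exact ⟨μ, ⟨hμ0, hμ1⟩, by simp only; rw [hμ, ← hl, h0]; simp⟩)
  have hre := congrArg Complex.re (hμ.trans hl.symm)
  have him := congrArg Complex.im (hμ.trans hl.symm)
  simp only [Complex.add_re, Complex.add_im, Complex.smul_re, Complex.smul_im, Complex.sub_re,
    Complex.sub_im, smul_eq_mul] at hre him hΔ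
  set Δ := (c.re - a.re) * (d.im - b.im) - (c.im - a.im) * (d.re - b.re) with hΔd
  have i1 : (b - a).re * (d - a).im - (b - a).im * (d - a).re = l * Δ := by
    simp only [Complex.sub_re, Complex.sub_im]
    linear_combination (d.im - b.im) * hre - (d.re - b.re) * him
  have i4 : (b - c).re * (d - c).im - (b - c).im * (d - c).re = -((1 - l) * Δ) := by
    simp only [Complex.sub_re, Complex.sub_im]
    linear_combination (d.im - b.im) * hre - (d.re - b.re) * him
  have i2 : (d - c).re * (d - a).im - (d - c).im * (d - a).re = -((1 - μ) * Δ) := by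
    simp only [Complex.sub_re, Complex.sub_im]
    linear_combination (c.im - a.im) * hre - (c.re - a.re) * him
  have i3 : (b - c).re * (b - a).im - (b - c).im * (b - a).re = μ * Δ := by
    simp only [Complex.sub_re, Complex.sub_im]
    linear_combination (c.im - a.im) * hre - (c.re - a.re) * him
  have hl2 : 0 < 1 - l := by linarith
  have hμ2 : 0 < 1 - μ := by linarith
  -- The crossing point is interior to both chords, so the sign of `Δ` determines all four
  -- arguments, and they have the same sense around the square.
  rcases lt_or_gt_of_ne hΔ with hneg | hpos
  · have p1 := arg_div_neg (i1.trans_lt (mul_neg_of_pos_of_neg hl0' hneg))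
    have p4 := arg_div_pos (i4.symm ▸ neg_pos.2 (mul_neg_of_pos_of_neg hl2 hneg))
    have p2 := arg_div_pos (i2.symm ▸ neg_pos.2 (mul_neg_of_pos_of_neg hμ2 hneg))
    have p3 := arg_div_neg (i3.trans_lt (mul_neg_of_pos_of_neg hμ0' hneg))
    linarith
  · have p1 := arg_div_pos (i1.symm ▸ mul_pos hl0' hpos)
    have p4 := arg_div_neg (i4.trans_lt (neg_neg_of_pos (mul_pos hl2 hpos)))
    have p2 := arg_div_neg (i2.trans_lt (neg_neg_of_pos (mul_pos hμ2 hpos)))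
    have p3 := arg_div_pos (i3.symm ▸ mul_pos hμ0' hpos)
    linarith

theorem disjoint_segment_of_disjoint_paths {a b c d : Plane} (γ : Path b d) (δ : Path a c)
    (h : ∀ s t, γ s ≠ δ t) (ha : ∀ s, a ∉ segment ℝ b (γ s)) (hc : ∀ s, c ∉ segment ℝ b (γ s))
    (hb : ∀ t, b ∉ segment ℝ c (δ t)) (hd : ∀ t, d ∉ segment ℝ c (δ t)) :
    Disjoint (segment ℝ b d) (segment ℝ a c) := by
  let φ : Plane ≃L[ℝ] ℂ := Complex.orthonormalBasisOneI.repr.symm.toContinuousLinearEquiv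
  have hseg : ∀ x y z : Plane, φ x ∈ segment ℝ (φ y) (φ z) → x ∈ segment ℝ y z := by
    intro x y z hx
    have := image_segment ℝ (φ : Plane →ₗ[ℝ] ℂ).toAffineMap y z
    have h2 : φ x ∈ (φ : Plane → ℂ) '' segment ℝ y z := by
      have e : (φ : Plane → ℂ) '' segment ℝ y z = segment ℝ (φ y) (φ z) := this
      rw [e]; exact hx
    obtain ⟨x', hx', he⟩ := h2
    exact φ.injective he ▸ hx'
  have := Complex.disjoint_segment_of_disjoint_paths (γ.map φ.continuous) (δ.map φ.continuous)
    (fun s t hst => h s t (φ.injective hst)) (fun s hs => ha s (hseg _ _ _ hs))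
    (fun s hs => hc s (hseg _ _ _ hs)) (fun s hs => hb s (hseg _ _ _ hs))
    (fun s hs => hd s (hseg _ _ _ hs))
  rw [Set.disjoint_left] at this ⊢
  intro w h1 h2
  have e : ∀ y z : Plane, (φ : Plane → ℂ) '' segment ℝ y z = segment ℝ (φ y) (φ z) :=
    fun y z => image_segment ℝ (φ : Plane →ₗ[ℝ] ℂ).toAffineMap y z
  exact this (a := φ w) (e b d ▸ Set.mem_image_of_mem _ h1) (e a c ▸ Set.mem_image_of_mem _ h2)

/-! ### Linear algebra and convex hulls in the plane -/

/-- The linear functional `x ↦ det (v, x)`. -/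
noncomputable def crossL (v : Plane) : Plane →L[ℝ] ℝ :=
  v 0 • EuclideanSpace.proj (1 : Fin 2) - v 1 • EuclideanSpace.proj (0 : Fin 2)

theorem crossL_apply (v x : Plane) : crossL v x = v 0 * x 1 - v 1 * x 0 := by
  simp [crossL]

@[simp] theorem crossL_self (v : Plane) : crossL v v = 0 := by
  rw [crossL_apply]; ring

theorem ne_zero_iff_coord {v : Plane} : v ≠ 0 ↔ v 0 ≠ 0 ∨ v 1 ≠ 0 := by
  rw [Ne, PiLp.ext_iff, Fin.forall_fin_two, not_and_or]; simp

theorem exists_smul_of_crossL_eq_zero {v x : Plane} (hv : v ≠ 0) (h : crossL v x = 0) :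
    ∃ t : ℝ, x = t • v := by
  rw [crossL_apply] at h
  rcases ne_zero_iff_coord.1 hv with h0 | h1
  · refine ⟨x 0 / v 0, ?_⟩
    ext i; fin_cases i
    · simp [h0]
    · simp; field_simp; linarith
  · refine ⟨x 1 / v 1, ?_⟩
    ext i; fin_cases i
    · simp; field_simp; linarith
    · simp [h1]

theorem exists_crossL_pos {v : Plane} (hv : v ≠ 0) : ∃ x, 0 < crossL v x := by
  refine ⟨!₂[-v 1, v 0], ?_⟩
  rw [crossL_apply]
  rcases ne_zero_iff_coord.1 hv with h0 | h1
  · have := mul_self_pos.2 h0; have := mul_self_nonneg (v 1); simp; nlinarith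
  · have := mul_self_pos.2 h1; have := mul_self_nonneg (v 0); simp; nlinarith

theorem exists_eq_crossL (f : Plane →L[ℝ] ℝ) : ∃ v, f = crossL v := by
  let e : Fin 2 → Plane := fun i => EuclideanSpace.single i (1 : ℝ)
  refine ⟨!₂[f (e 1), -f (e 0)], ?_⟩
  ext x
  have hx : x = x 0 • e 0 + x 1 • e 1 := by
    ext i; fin_cases i <;> simp [e]
  nth_rw 1 [hx]
  rw [map_add, map_smul, map_smul, crossL_apply]
  simp; ring

theorem IsOpen.openSegment_subset_of_mem_closure {A : Set Plane} (hA : IsOpen A)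
    (hc : Convex ℝ A) {x y : Plane} (hx : x ∈ A) (hy : y ∈ closure A) : openSegment ℝ x y ⊆ A := by
  have := hc.openSegment_interior_closure_subset_interior (x := x) (y := y)
    (by rwa [hA.interior_eq]) hy
  rwa [hA.interior_eq] at this

theorem IsOpen.segment_subset_insert {A : Set Plane} (hA : IsOpen A)
    (hc : Convex ℝ A) {x y : Plane} (hx : x ∈ A) (hy : y ∈ closure A) :
    segment ℝ x y ⊆ insert y A := by
  rw [← insert_endpoints_openSegment]
  rintro z (rfl | rfl | hz)
  · exact Or.inr hx
  · exact Or.inl rfl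
  · exact Or.inr (hA.openSegment_subset_of_mem_closure hc hx hy hz)

theorem IsOpen.interior_closure_of_convex {A : Set Plane} (hA : IsOpen A) (hc : Convex ℝ A) :
    interior (closure A) = A := by
  rcases A.eq_empty_or_nonempty with rfl | hne
  · simp
  · rw [hc.interior_closure_eq_interior_of_nonempty_interior (by rwa [hA.interior_eq]),
      hA.interior_eq]

theorem convexHull_closure_subset (U : Set Plane) :
    convexHull ℝ (closure U) ⊆ closure (convexHull ℝ U) :=
  convexHull_min (closure_mono (subset_convexHull ℝ U)) (convex_convexHull ℝ U).closure

theorem IsCompact.convexJoin {S T : Set Plane} (hS : IsCompact S) (hT : IsCompact T) :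
    IsCompact (_root_.convexJoin ℝ S T) := by
  have h := ((hS.prod hT).prod (isCompact_Icc (a := (0 : ℝ)) (b := 1))).image
    (f := fun p : (Plane × Plane) × ℝ => (1 - p.2) • p.1.1 + p.2 • p.1.2) (by fun_prop)
  convert h using 1
  ext x
  simp only [mem_convexJoin, segment_eq_image, mem_image, Prod.exists, mem_prod]
  constructor
  · rintro ⟨a, ha, b, hb, θ, hθ, rfl⟩
    exact ⟨a, b, θ, ⟨⟨ha, hb⟩, hθ⟩, rfl⟩
  · rintro ⟨a, b, θ, ⟨⟨ha, hb⟩, hθ⟩, rfl⟩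
    exact ⟨a, ha, b, hb, θ, hθ, rfl⟩

theorem exists_affineIndependent_of_mem_convexHull {S : Set Plane} {x : Plane}
    (hx : x ∈ convexHull ℝ S) : ∃ t : Finset Plane, ↑t ⊆ S ∧ x ∈ convexHull ℝ (t : Set Plane) ∧
      AffineIndependent ℝ ((↑) : t → Plane) ∧ t.card ≤ 3 := by
  rw [convexHull_eq_union] at hx
  simp only [mem_iUnion] at hx
  obtain ⟨t, ht, hind, hxt⟩ := hx
  refine ⟨t, ht, hxt, hind, ?_⟩
  have := hind.card_le_finrank_succ
  rw [Fintype.card_coe] at this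
  have h2 := Submodule.finrank_le (vectorSpan ℝ (range ((↑) : t → Plane)))
  rw [finrank_euclideanSpace_fin] at h2
  omega

theorem exists_triple_of_mem_convexHull {S : Set Plane} {x : Plane} (hx : x ∈ convexHull ℝ S) :
    ∃ a ∈ S, ∃ b ∈ S, ∃ c ∈ S, x ∈ convexHull ℝ {a, b, c} := by
  obtain ⟨t, ht, hxt, -, hcard⟩ := exists_affineIndependent_of_mem_convexHull hx
  have hne : t.card ≠ 0 := by
    rw [Ne, Finset.card_eq_zero]; rintro rfl; simp at hxt
  have : t.card = 1 ∨ t.card = 2 ∨ t.card = 3 := by omega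
  rcases this with h | h | h
  · obtain ⟨a, rfl⟩ := Finset.card_eq_one.1 h
    simp at ht hxt
    exact ⟨a, ht, a, ht, a, ht, by simpa⟩
  · obtain ⟨a, b, -, rfl⟩ := Finset.card_eq_two.1 h
    simp only [Finset.coe_insert, Finset.coe_singleton, insert_subset_iff,
      singleton_subset_iff] at ht hxt
    exact ⟨a, ht.1, a, ht.1, b, ht.2, by simpa using hxt⟩
  · obtain ⟨a, b, c, -, -, -, rfl⟩ := Finset.card_eq_three.1 h
    simp only [Finset.coe_insert, Finset.coe_singleton, insert_subset_iff,
      singleton_subset_iff] at ht hxt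
    exact ⟨a, ht.1, b, ht.2.1, c, ht.2.2, hxt⟩

/-- By Carathéodory the hull is an iterated join of three copies of `S`, a continuous image of a
compact set. -/
theorem isCompact_convexHull {S : Set Plane} (hS : IsCompact S) : IsCompact (convexHull ℝ S) := by
  have : convexHull ℝ S = convexJoin ℝ S (convexJoin ℝ S S) := by
    refine Subset.antisymm (fun x hx => ?_) ?_
    · obtain ⟨a, ha, b, hb, c, hc, hx⟩ := exists_triple_of_mem_convexHull hx
      rw [convexHull_insert (by simp), convexHull_pair, ← convexJoin_singletons] at hx
      exact convexJoin_mono (by simpa) (convexJoin_mono (by simpa) (by simpa)) hx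
    · have hc := convex_convexHull ℝ S
      have hs := subset_convexHull ℝ S
      exact convexJoin_subset hs (convexJoin_subset hs hs hc) hc
  rw [this]
  exact hS.convexJoin (hS.convexJoin hS)

/-! ### Blocking one hull by a path in the other -/

/-- A line through two points outside of an open convex set `B`, between which it meets the closure
of `B`, meets `B` only between these points. -/
theorem exists_mem_segment_inter_of_crossL {B : Set Plane} (hB : IsOpen B) (hc : Convex ℝ B)
    {a b c d z : Plane} (hb : b ∉ B) (hd : d ∉ B) (hz : z ∈ openSegment ℝ b d)
    (hzB : z ∈ closure B) (ha : a ∈ B) (hcB : c ∈ B) (hpos : 0 < crossL (d - b) (a - b))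
    (hneg : crossL (d - b) (c - b) < 0) : ¬ Disjoint (segment ℝ b d) (segment ℝ a c) := by
  have hv : d - b ≠ 0 := by intro h; rw [h] at hpos; simp [crossL_apply] at hpos
  set p := crossL (d - b) (a - b)
  set q := crossL (d - b) (c - b)
  have hpq : 0 < p - q := by linarith
  let w : Plane := (-q / (p - q)) • a + (p / (p - q)) • c
  have hw : w ∈ segment ℝ a c :=
    ⟨_, _, div_nonneg (by linarith) hpq.le, div_nonneg hpos.le hpq.le, by field_simp; ring, rfl⟩
  have hwB : w ∈ B := hc.segment_subset ha hcB hw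
  have hwb : w - b = (-q / (p - q)) • (a - b) + (p / (p - q)) • (c - b) := by
    have : b = (-q / (p - q)) • b + (p / (p - q)) • b := by
      rw [← add_smul, ← add_div, neg_add_eq_sub, div_self hpq.ne', one_smul]
    nth_rw 1 [this]; simp only [w]; module
  have hw0 : crossL (d - b) (w - b) = 0 := by
    rw [hwb, map_add, map_smul, map_smul, smul_eq_mul, smul_eq_mul]
    change -q / (p - q) * p + p / (p - q) * q = 0
    field_simp; ring
  obtain ⟨t, ht⟩ := exists_smul_of_crossL_eq_zero hv hw0
  have hwt : w = b + t • (d - b) := by rw [← ht]; abel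
  rw [openSegment_eq_image'] at hz
  obtain ⟨s, ⟨hs0, hs1⟩, rfl⟩ := hz
  rw [Set.not_disjoint_iff]
  refine ⟨w, ?_, hw⟩
  have key := hB.openSegment_subset_of_mem_closure hc hwB hzB
  rw [segment_eq_image']
  refine ⟨t, ⟨?_, ?_⟩, hwt.symm⟩
  -- If `w` came before `b` on the line, then `b` would lie strictly between `w ∈ B` and `z ∈
  -- closure B`, hence in `B`. The other end is symmetric.
  · by_contra h
    push Not at h
    refine hb (key ⟨s / (s - t), -t / (s - t), by apply div_pos <;> linarith, by
      apply div_pos <;> linarith, by rw [← add_div]; exact div_self (by linarith), ?_⟩)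
    have : s - t ≠ 0 := by linarith
    have e1 : s / (s - t) + -t / (s - t) = 1 := by field_simp; ring
    have e2 : s / (s - t) * t + -t / (s - t) * s = 0 := by field_simp; ring
    simp only [hwt]
    linear_combination (norm := module) e1 • b + e2 • (d - b)
  · by_contra h
    push Not at h
    refine hd (key ⟨(1 - s) / (t - s), (t - 1) / (t - s), by apply div_pos <;> linarith, by
      apply div_pos <;> linarith, by rw [← add_div, div_eq_one_iff_eq] <;> linarith, ?_⟩)
    have : t - s ≠ 0 := by linarith
    have e1 : (1 - s) / (t - s) + (t - 1) / (t - s) = 1 := by field_simp; ring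
    have e2 : (1 - s) / (t - s) * t + (t - 1) / (t - s) * s = 1 := by field_simp; ring
    simp only [hwt]
    linear_combination (norm := module) e1 • b + e2 • (d - b)

/-- A line strictly separates `a` from `K`. Since `a` is in the hull of `V`, some point of `V` is on
the side of `a`, and the segment to it stays on that side. -/
theorem exists_segment_subset_diff {V K : Set Plane} (hK : IsClosed K) (hKc : Convex ℝ K)
    {a : Plane} (ha : a ∈ convexHull ℝ V) (haK : a ∉ K) :
    ∃ v ∈ V, segment ℝ a v ⊆ convexHull ℝ V \ K := by
  obtain ⟨f, u, hu, hf⟩ := geometric_hahn_banach_point_closed hKc hK haK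
  obtain ⟨v, hv, hvu⟩ : ∃ v ∈ V, f v < u := by
    by_contra! h
    have : convexHull ℝ V ⊆ {x | u ≤ f x} :=
      convexHull_min h ((convex_Ici u).is_linear_preimage f.isLinear)
    exact (this ha).not_gt hu
  refine ⟨v, hv, fun x hx => ⟨(convex_convexHull ℝ V).segment_subset ha
    (subset_convexHull ℝ V hv) hx, fun hxK => ?_⟩⟩
  have : segment ℝ a v ⊆ {x | f x < u} :=
    ((convex_Iio u).is_linear_preimage f.isLinear).segment_subset hu hvu
  exact (hf x hxK).not_gt (this hx)

/-- Both points escape to `V` along segments that avoid `K`, and `V` is path connected. Only inside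
`V` may the path enter `K`, which is harmless when `K` is the hull of a path that avoids `V`. -/
theorem joinedIn_hull_diff {V K : Set Plane} (hV : IsOpen V) (hVc : IsConnected V)
    (hK : IsClosed K) (hKc : Convex ℝ K) {a c : Plane}
    (ha : a ∈ convexHull ℝ V \ K) (hc : c ∈ convexHull ℝ V \ K) :
    JoinedIn (V ∪ (convexHull ℝ V \ K)) a c := by
  obtain ⟨v, hv, hav⟩ := exists_segment_subset_diff hK hKc ha.1 ha.2
  obtain ⟨w, hw, hcw⟩ := exists_segment_subset_diff hK hKc hc.1 hc.2
  have h1 := (JoinedIn.of_segment_subset hav).mono (subset_union_right (s := V))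
  have h2 := (JoinedIn.of_segment_subset hcw).mono (subset_union_right (s := V))
  have h3 : JoinedIn V v w := (hV.isConnected_iff_isPathConnected.1 hVc).joinedIn v hv w hw
  exact (h1.trans (h3.mono subset_union_left)).trans h2.symm

/-- A path `γ` that avoids the connected open set `V` separates no two points of the hull of `V`
that are outside of the hull of `γ`. -/
theorem disjoint_segment_of_path_disjoint {V : Set Plane} (hV : IsOpen V) (hVc : IsConnected V)
    {a b c d : Plane} (γ : Path b d) (hγ : Disjoint (range γ) V)
    (hb : b ∉ convexHull ℝ V) (hd : d ∉ convexHull ℝ V)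
    (ha : a ∈ convexHull ℝ V \ convexHull ℝ (range γ))
    (hc : c ∈ convexHull ℝ V \ convexHull ℝ (range γ)) :
    Disjoint (segment ℝ b d) (segment ℝ a c) := by
  have hcomp : IsCompact (convexHull ℝ (range γ)) := isCompact_convexHull (isCompact_range γ.continuous)
  obtain ⟨δ, hδ⟩ := joinedIn_hull_diff hV hVc hcomp.isClosed (convex_convexHull ℝ _) ha hc
  have hsub : ∀ s, segment ℝ b (γ s) ⊆ convexHull ℝ (range γ) := fun s =>
    (convex_convexHull ℝ _).segment_subset (subset_convexHull ℝ _ ⟨0, γ.source⟩)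
      (subset_convexHull ℝ _ ⟨s, rfl⟩)
  have hδB : ∀ t, δ t ∈ convexHull ℝ V := fun t =>
    (hδ t).elim (fun h => subset_convexHull ℝ V h) (fun h => h.1)
  have hsub' : ∀ t, segment ℝ c (δ t) ⊆ convexHull ℝ V := fun t =>
    (convex_convexHull ℝ _).segment_subset hc.1 (hδB t)
  refine disjoint_segment_of_disjoint_paths γ δ (fun s t hst => ?_) (fun s h => ha.2 (hsub s h))
    (fun s h => hc.2 (hsub s h)) (fun t h => hb (hsub' t h)) (fun t h => hd (hsub' t h))
  rcases hδ t with h | h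
  · exact Set.disjoint_left.1 hγ ⟨s, rfl⟩ (hst ▸ h)
  · exact h.2 (hst ▸ subset_convexHull ℝ _ ⟨s, rfl⟩)

theorem crossL_swap (b d x : Plane) : crossL (b - d) (x - d) = -crossL (d - b) (x - b) := by
  simp only [crossL_apply, PiLp.sub_apply]; ring

/-- The point `b` can be reached from `U` inside the hull of `U`, avoiding `V`. -/
def ReachableAvoiding (U V : Set Plane) (b : Plane) : Prop :=
  ∃ u ∈ U, JoinedIn (insert b (convexHull ℝ U \ V)) b u

theorem convex_union_segment {A : Set Plane} (hA : IsOpen A) (hc : Convex ℝ A) {b d : Plane}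
    (hb : b ∈ closure A) (hd : d ∈ closure A) : Convex ℝ (A ∪ segment ℝ b d) := by
  have hs : segment ℝ b d ⊆ closure A := hc.closure.segment_subset hb hd
  have key : ∀ x ∈ A, ∀ y ∈ A ∪ segment ℝ b d, segment ℝ x y ⊆ A ∪ segment ℝ b d := by
    rintro x hx y hy
    have hyc : y ∈ closure A := hy.elim (fun h => subset_closure h) (fun h => hs h)
    intro w hw
    rcases hA.segment_subset_insert hc hx hyc hw with rfl | h
    · exact hy
    · exact Or.inl h
  rw [convex_iff_segment_subset]
  rintro x (hx | hx) y hy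
  · exact key x hx y hy
  · rcases hy with hy | hy
    · rw [segment_symm]; exact key y hy x (Or.inr hx)
    · exact ((convex_segment b d).segment_subset hx hy).trans subset_union_right

/-- A compact convex set that blocks the hull of `V` on a chord of the hull of `U`. -/
theorem exists_blocking_set {U V : Set Plane} (hU : IsOpen U) (hUc : IsConnected U)
    (hV : IsOpen V) (hVc : IsConnected V) (hUV : Disjoint U V) {b d : Plane}
    (hb : ReachableAvoiding U V b) (hd : ReachableAvoiding U V d)
    (hbV : b ∉ convexHull ℝ V) (hdV : d ∉ convexHull ℝ V)
    (hbU : b ∈ closure (convexHull ℝ U)) (hdU : d ∈ closure (convexHull ℝ U)) :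
    ∃ K : Set Plane, IsCompact K ∧ b ∈ K ∧ d ∈ K ∧ Convex ℝ K ∧
      K ⊆ convexHull ℝ U ∪ segment ℝ b d ∧
      ∀ a ∈ convexHull ℝ V \ K, ∀ c ∈ convexHull ℝ V \ K,
        Disjoint (segment ℝ b d) (segment ℝ a c) := by
  obtain ⟨u, hu, hbu⟩ := hb
  obtain ⟨w, hw, hdw⟩ := hd
  have huw : JoinedIn U u w := (hU.isConnected_iff_isPathConnected.1 hUc).joinedIn u hu w hw
  have hsub : U ⊆ convexHull ℝ U \ V := fun x hx =>
    ⟨subset_convexHull ℝ U hx, Set.disjoint_left.1 hUV hx⟩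
  set S := insert b (insert d (convexHull ℝ U \ V)) with hS
  have h1 : JoinedIn S b u := hbu.mono (insert_subset_insert (subset_insert _ _))
  have h2 : JoinedIn S d w := hdw.mono (subset_insert _ _)
  have h3 : JoinedIn S u w := huw.mono
    (hsub.trans ((subset_insert _ _).trans (subset_insert _ _)))
  obtain ⟨γ, hγ⟩ := (h1.trans h3).trans h2.symm
  have hVsub := subset_convexHull ℝ V
  refine ⟨convexHull ℝ (range γ), isCompact_convexHull (isCompact_range γ.continuous),
    subset_convexHull ℝ _ ⟨0, γ.source⟩, subset_convexHull ℝ _ ⟨1, γ.target⟩,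
    convex_convexHull ℝ _, ?_, fun a ha c hc =>
      disjoint_segment_of_path_disjoint hV hVc γ ?_ hbV hdV ha hc⟩
  · refine convexHull_min ?_ (convex_union_segment hU.convexHull (convex_convexHull ℝ U) hbU hdU)
    rintro _ ⟨t, rfl⟩
    rcases hγ t with h | h | h
    · rw [h]; exact Or.inr (left_mem_segment ℝ b d)
    · rw [h]; exact Or.inr (right_mem_segment ℝ b d)
    · exact Or.inl h.1
  · rw [Set.disjoint_left]
    rintro _ ⟨t, rfl⟩ htV
    rcases hγ t with h | h | h
    · exact hbV (h ▸ hVsub htV)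
    · exact hdV (h ▸ hVsub htV)
    · exact h.2 htV

/-- If points of the hull of `V` outside `K` existed strictly on both sides of the line `bd`, the
segment between them would cross the line between `b` and `d`, because the line already meets the
closure of the hull there. -/
theorem exists_blocking_side {U V : Set Plane} (hU : IsOpen U) (hUc : IsConnected U)
    (hV : IsOpen V) (hVc : IsConnected V) (hUV : Disjoint U V) {b d z : Plane}
    (hb : ReachableAvoiding U V b) (hd : ReachableAvoiding U V d)
    (hbV : b ∉ convexHull ℝ V) (hdV : d ∉ convexHull ℝ V)
    (hbU : b ∈ closure (convexHull ℝ U)) (hdU : d ∈ closure (convexHull ℝ U))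
    (hz : z ∈ openSegment ℝ b d) (hzV : z ∈ closure (convexHull ℝ V)) :
    ∃ K : Set Plane, IsCompact K ∧ b ∈ K ∧ d ∈ K ∧ Convex ℝ K ∧
      K ⊆ convexHull ℝ U ∪ segment ℝ b d ∧
      ((∀ x ∈ convexHull ℝ V, 0 < crossL (d - b) (x - b) → x ∈ K) ∨
        (∀ x ∈ convexHull ℝ V, crossL (d - b) (x - b) < 0 → x ∈ K)) := by
  obtain ⟨K, h1, h2, h3, h4, h5, h6⟩ :=
    exists_blocking_set hU hUc hV hVc hUV hb hd hbV hdV hbU hdU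
  refine ⟨K, h1, h2, h3, h4, h5, ?_⟩
  by_contra! h
  obtain ⟨⟨a, haV, hpos, haK⟩, c, hcV, hneg, hcK⟩ := h
  exact exists_mem_segment_inter_of_crossL hV.convexHull (convex_convexHull ℝ V) hbV hdV hz hzV
    haV hcV hpos hneg (h6 a ⟨haV, haK⟩ c ⟨hcV, hcK⟩)

/-! ### Connectedness of the difference for open hulls -/

/-- A ray that starts in the convex set `E` does not return to `E` once it has left. -/
theorem segment_subset_diff_of_ray {Z E : Set Plane} (hZ : Convex ℝ Z) (hE : Convex ℝ E)
    {z y : Plane} {k : ℝ} (hk : 0 < k) (hz : z ∈ E) (hy : y ∈ Z \ E)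
    (hy' : z + k • (y - z) ∈ Z \ E) : segment ℝ y (z + k • (y - z)) ⊆ Z \ E := by
  intro p hp
  refine ⟨hZ.segment_subset hy.1 hy'.1 hp, fun hpE => ?_⟩
  obtain ⟨s, t, hs, ht, hst, rfl⟩ := hp
  set p := s • y + t • (z + k • (y - z)) with hpdef
  have hpz : p = z + (s + t * k) • (y - z) := by
    have : s = 1 - t := by linarith
    rw [hpdef, this]; module
  set κ := s + t * k
  have hscale : ∀ r : ℝ, 0 < r → r ≤ κ → z + r • (y - z) ∈ E := by
    intro r hr hrκ
    have hκ : 0 < κ := hr.trans_le hrκ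
    have : z + r • (y - z) = z + (r / κ) • (p - z) := by
      rw [hpz, add_sub_cancel_left, smul_smul, div_mul_cancel₀ _ hκ.ne']
    rw [this]
    exact hE.add_smul_sub_mem hz hpE ⟨by positivity, (div_le_one hκ).2 hrκ⟩
  rcases le_total k 1 with h | h
  · exact hy'.2 (hscale k hk (by nlinarith))
  · have := hscale 1 one_pos (by nlinarith)
    rw [one_smul, add_sub_cancel] at this
    exact hy.2 this

/-- Walking around a convex set `E` inside a convex open set `Z`. -/
theorem exists_preconnected_around {Z E : Set Plane} (hZ : IsOpen Z) (hZc : Convex ℝ Z)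
    (hEc : Convex ℝ E) {b d z : Plane} (hb : b ∈ Z \ E) (hd : d ∈ Z \ E)
    (hz : z ∈ openSegment ℝ b d) (hzE : z ∈ E)
    (hcomp : IsCompact (E ∩ {x | 0 ≤ crossL (d - b) (x - b)}))
    (hsub : E ∩ {x | 0 ≤ crossL (d - b) (x - b)} ⊆ Z) :
    ∃ T, IsPreconnected T ∧ T ⊆ Z \ E ∧ b ∈ T ∧ d ∈ T := by
  set E' := E ∩ {x | 0 ≤ crossL (d - b) (x - b)} with hE'
  obtain ⟨δ, hδ, hδZ⟩ := hcomp.exists_cthickening_subset_open hZ hsub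
  have hzb : b ≠ z := by rintro rfl; exact hb.2 hzE
  have hzd : d ≠ z := by rintro rfl; exact hd.2 hzE
  have hbd : b ≠ d := by rintro rfl; simp at hz; exact hzb hz.symm
  have hv : d - b ≠ 0 := sub_ne_zero.2 hbd.symm
  have hzh : crossL (d - b) (z - b) = 0 := by
    rw [openSegment_eq_image'] at hz
    obtain ⟨s, -, rfl⟩ := hz
    simp
  have hzE' : z ∈ E' := ⟨hzE, hzh.ge⟩
  have hhalf : Convex ℝ {x | 0 ≤ crossL (d - b) (x - b)} := by
    have : {x | 0 ≤ crossL (d - b) (x - b)} = {x | crossL (d - b) b ≤ crossL (d - b) x} := by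
      ext x; simp [map_sub]
    rw [this]; exact (convex_Ici _).is_linear_preimage (crossL (d - b)).isLinear
  have hE'c : Convex ℝ E' := hEc.inter hhalf
  -- The detour follows the boundary of a thickening of `E'` that is still inside `Z`. It is moved
  -- to the origin so that its gauge gives the radial projection `m` from `z` onto that boundary.
  set W : Set Plane := (fun x => z + x) ⁻¹' Metric.thickening δ E' with hW
  have hWc : Convex ℝ W := (hE'c.thickening δ).translate_preimage_right z
  have hWo : IsOpen W := Metric.isOpen_thickening.preimage (by fun_prop)
  have hW0 : W ∈ nhds 0 := hWo.mem_nhds (by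
    simpa [hW] using Metric.self_subset_thickening hδ E' hzE')
  have hWb : Bornology.IsBounded W := by
    have : W = (fun x => -z + x) '' Metric.thickening δ E' := by
      ext x; simp [hW]
    rw [this]
    exact (hcomp.isBounded.thickening (δ := δ)).vadd (-z)
  have hg : Continuous (gauge W) := continuous_gauge hWc hW0
  have hgpos : ∀ x, x ≠ 0 → 0 < gauge W x := fun x hx =>
    (gauge_pos (absorbent_nhds_zero hW0) (NormedSpace.isVonNBounded_iff ℝ |>.2 hWb)).2 hx
  set m : Plane → Plane := fun x => z + (gauge W x)⁻¹ • x with hm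
  have hmem : ∀ x, x ≠ 0 → 0 ≤ crossL (d - b) x → m x ∈ Z \ E := by
    intro x hx hpos
    have h0 := hgpos x hx
    have h1 : gauge W ((gauge W x)⁻¹ • x) = 1 := by
      rw [gauge_smul_of_nonneg (by positivity), smul_eq_mul, inv_mul_cancel₀ h0.ne']
    have hfr := (gauge_eq_one_iff_mem_frontier hWc hW0).1 h1
    rw [hWo.frontier_eq] at hfr
    refine ⟨hδZ (Metric.closure_thickening_subset_cthickening δ E' ?_), fun hmE => hfr.2 ?_⟩
    · have hcont : Continuous fun x : Plane => z + x := by fun_prop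
      exact hcont.closure_preimage_subset (Metric.thickening δ E') hfr.1
    · refine Metric.self_subset_thickening hδ E' ⟨hmE, ?_⟩
      have : m x - b = (z - b) + (gauge W x)⁻¹ • x := by simp only [hm]; abel
      change 0 ≤ crossL (d - b) (m x - b)
      rw [this, map_add, hzh, map_smul, zero_add, smul_eq_mul]
      positivity
  -- The half-turn from `b - z` to `d - z` goes through `e`: two segments that avoid the origin and
  -- stay in the closed half-plane.
  obtain ⟨e, he⟩ := exists_crossL_pos hv
  have hseg : ∀ y, y ≠ z → crossL (d - b) (y - z) = 0 → ∀ x ∈ segment ℝ (y - z) e,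
      x ≠ 0 ∧ 0 ≤ crossL (d - b) x := by
    rintro y hy hy0 _ ⟨s, t, hs, ht, hst, rfl⟩
    have hval : crossL (d - b) (s • (y - z) + t • e) = t * crossL (d - b) e := by
      rw [map_add, map_smul, map_smul, hy0]; simp
    refine ⟨fun h => ?_, by rw [hval]; positivity⟩
    rw [h, map_zero] at hval
    have ht0 : t = 0 := by
      rcases mul_eq_zero.1 hval.symm with h | h
      · exact h
      · exact absurd h he.ne'
    have hs1 : s = 1 := by linarith
    rw [ht0, hs1] at h
    simp only [one_smul, zero_smul, add_zero] at h
    exact hy (sub_eq_zero.1 h)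
  have hb0 : crossL (d - b) (b - z) = 0 := by
    rw [← neg_sub z b, map_neg, hzh, neg_zero]
  have hd0 : crossL (d - b) (d - z) = 0 := by
    have : d - z = (d - b) - (z - b) := by abel
    rw [this, map_sub, hzh, crossL_self, sub_zero]
  have hmc : ∀ y, y ≠ z → crossL (d - b) (y - z) = 0 →
      IsPreconnected (m '' segment ℝ (y - z) e) := by
    intro y hy hy0
    refine (convex_segment _ _).isPreconnected.image _ ?_
    refine continuousOn_const.add (ContinuousOn.smul (hg.continuousOn.inv₀ ?_) continuousOn_id)
    exact fun x hx => (hgpos x (hseg y hy hy0 x hx).1).ne'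
  have hpiece : ∀ y, y ∈ Z \ E → y ≠ z → crossL (d - b) (y - z) = 0 →
      ∃ T, IsPreconnected T ∧ T ⊆ Z \ E ∧ y ∈ T ∧ m e ∈ T := by
    intro y hyZ hy hy0
    have hmy : m (y - z) ∈ Z \ E := hmem _ (sub_ne_zero.2 hy) hy0.ge
    refine ⟨segment ℝ y (m (y - z)) ∪ m '' segment ℝ (y - z) e,
      IsPreconnected.union (m (y - z)) (right_mem_segment ℝ _ _)
        ⟨_, left_mem_segment ℝ _ _, rfl⟩ (convex_segment _ _).isPreconnected (hmc y hy hy0), ?_,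
      Or.inl (left_mem_segment ℝ _ _), Or.inr ⟨e, right_mem_segment ℝ _ _, rfl⟩⟩
    refine union_subset ?_ ?_
    · exact segment_subset_diff_of_ray hZc hEc (inv_pos.2 (hgpos _ (sub_ne_zero.2 hy))) hzE hyZ hmy
    · rintro _ ⟨x, hx, rfl⟩
      exact hmem x (hseg y hy hy0 x hx).1 (hseg y hy hy0 x hx).2
  obtain ⟨T₁, h1, h2, h3, h4⟩ := hpiece b hb hzb hb0
  obtain ⟨T₂, k1, k2, k3, k4⟩ := hpiece d hd hzd hd0
  exact ⟨T₁ ∪ T₂, h1.union _ h4 k4 k1, union_subset h2 k2, Or.inl h3, Or.inr k3⟩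

theorem reachableAvoiding_of_notMem_closure {U V : Set Plane} {b : Plane}
    (hb : b ∈ convexHull ℝ U) (hbV : b ∉ closure (convexHull ℝ V)) :
    ReachableAvoiding U V b := by
  obtain ⟨u, hu, hsub⟩ := exists_segment_subset_diff (V := U) isClosed_closure
    (convex_convexHull ℝ V).closure hb hbV
  refine ⟨u, hu, JoinedIn.of_segment_subset fun x hx => Or.inr ⟨(hsub hx).1, fun hxV => ?_⟩⟩
  exact (hsub hx).2 (subset_closure (subset_convexHull ℝ V hxV))

theorem mem_openSegment_of_mem_segment {b d z : Plane} (hz : z ∈ segment ℝ b d) (hb : b ≠ z)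
    (hd : d ≠ z) : z ∈ openSegment ℝ b d := mem_openSegment_of_ne_left_right hb hd hz

/-- Points of the closure of `B` on a line through `b, d ∉ closure B` that meets the closure of `B`
between `b` and `d` are between `b` and `d`. -/
theorem mem_segment_of_crossL_eq_zero {E : Set Plane} (hE : Convex ℝ E) {b d z x : Plane}
    (hb : b ∉ E) (hd : d ∉ E) (hz : z ∈ segment ℝ b d) (hzE : z ∈ E) (hx : x ∈ E)
    (h0 : crossL (d - b) (x - b) = 0) : x ∈ segment ℝ b d := by
  have hbd : d - b ≠ 0 := by
    intro h
    rw [sub_eq_zero.1 h, segment_same] at hz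
    exact hb (hz ▸ hzE)
  obtain ⟨t, ht⟩ := exists_smul_of_crossL_eq_zero hbd h0
  have hxt : x = b + t • (d - b) := by rw [← ht]; abel
  rw [segment_eq_image'] at hz ⊢
  obtain ⟨s, ⟨hs0, hs1⟩, rfl⟩ := hz
  refine ⟨t, ⟨?_, ?_⟩, hxt.symm⟩
  · by_contra h
    push Not at h
    refine hb (hE hx hzE (a := s / (s - t)) (b := -t / (s - t)) (by apply div_nonneg <;> linarith)
      (by apply div_nonneg <;> linarith)
      (by rw [← add_div]; exact div_self (by linarith)) |> fun h' => ?_)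
    have : s - t ≠ 0 := by linarith
    convert h' using 1
    have e1 : s / (s - t) + -t / (s - t) = 1 := by field_simp; ring
    have e2 : s / (s - t) * t + -t / (s - t) * s = 0 := by field_simp; ring
    rw [hxt]
    linear_combination (norm := module) (-1 : ℝ) • (e1 • b + e2 • (d - b))
  · by_contra h
    push Not at h
    refine hd (hE hx hzE (a := (1 - s) / (t - s)) (b := (t - 1) / (t - s))
      (by apply div_nonneg <;> linarith) (by apply div_nonneg <;> linarith)
      (by rw [← add_div, div_eq_one_iff_eq] <;> linarith) |> fun h' => ?_)
    have : t - s ≠ 0 := by linarith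
    convert h' using 1
    have e1 : (1 - s) / (t - s) + (t - 1) / (t - s) = 1 := by field_simp; ring
    have e2 : (1 - s) / (t - s) * t + (t - 1) / (t - s) * s = 1 := by field_simp; ring
    rw [hxt]
    linear_combination (norm := module) (-1 : ℝ) • (e1 • b + e2 • (d - b))

theorem closure_inter_halfPlane_subset {B K : Set Plane} (hK : IsClosed K) (v b : Plane)
    (h : ∀ x ∈ B, 0 < crossL v (x - b) → x ∈ K) {x : Plane} (hx : x ∈ closure B)
    (hpos : 0 < crossL v (x - b)) : x ∈ K := by
  have ho : IsOpen {x | 0 < crossL v (x - b)} := isOpen_lt (by fun_prop) (by fun_prop)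
  have hx' : x ∈ closure (B ∩ {x | 0 < crossL v (x - b)}) := ho.closure_inter ⟨hx, hpos⟩
  exact hK.closure_subset_iff.2 (fun y hy => h y hy.1 hy.2) hx'

/-- Either the chord `bd` itself avoids the closure of `B`, or one side of this closure is contained
in a compact subset of `A`, and there is room in `A` to walk around it. -/
theorem isPreconnected_hull_diff_closure {U V : Set Plane} (hU : IsOpen U) (hUc : IsConnected U)
    (hV : IsOpen V) (hVc : IsConnected V) (hUV : Disjoint U V) :
    IsPreconnected (convexHull ℝ U \ closure (convexHull ℝ V)) := by
  set A := convexHull ℝ U with hA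
  set B := convexHull ℝ V with hB
  have hAc : Convex ℝ A := convex_convexHull ℝ U
  have hBc : Convex ℝ B := convex_convexHull ℝ V
  have hAo : IsOpen A := hU.convexHull
  refine isPreconnected_of_forall_pair fun b hb d hd => ?_
  by_cases hdis : Disjoint (segment ℝ b d) (closure B)
  · exact ⟨segment ℝ b d, fun x hx => ⟨hAc.segment_subset hb.1 hd.1 hx,
      Set.disjoint_left.1 hdis hx⟩, left_mem_segment ℝ _ _, right_mem_segment ℝ _ _,
      (convex_segment _ _).isPreconnected⟩
  obtain ⟨z, hz, hzB⟩ := Set.not_disjoint_iff.1 hdis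
  have hzo : z ∈ openSegment ℝ b d := mem_openSegment_of_mem_segment hz
    (by rintro rfl; exact hb.2 hzB) (by rintro rfl; exact hd.2 hzB)
  obtain ⟨K, hK, hbK, hdK, hKc, hKA, hside⟩ := exists_blocking_side hU hUc hV hVc hUV
    (reachableAvoiding_of_notMem_closure hb.1 hb.2) (reachableAvoiding_of_notMem_closure hd.1 hd.2)
    (fun h => hb.2 (subset_closure h)) (fun h => hd.2 (subset_closure h)) (subset_closure hb.1)
    (subset_closure hd.1) hzo hzB
  have hKA' : K ⊆ A := hKA.trans (union_subset subset_rfl (hAc.segment_subset hb.1 hd.1))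
  have around : ∀ b d : Plane, b ∈ A \ closure B → d ∈ A \ closure B → b ∈ K → d ∈ K →
      z ∈ openSegment ℝ b d → (∀ x ∈ B, 0 < crossL (d - b) (x - b) → x ∈ K) →
      ∃ t ⊆ A \ closure B, b ∈ t ∧ d ∈ t ∧ IsPreconnected t := by
    intro b d hb hd hbK hdK hz hs
    have hsub : closure B ∩ {x | 0 ≤ crossL (d - b) (x - b)} ⊆ K := by
      rintro x ⟨hx, hx0⟩
      rcases eq_or_lt_of_le (show 0 ≤ crossL (d - b) (x - b) from hx0) with h | h
      · exact hKc.segment_subset hbK hdK (mem_segment_of_crossL_eq_zero hBc.closure hb.2 hd.2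
          (openSegment_subset_segment ℝ _ _ hz) hzB hx h.symm)
      · exact closure_inter_halfPlane_subset hK.isClosed _ _ hs hx h
    have hcl : IsClosed (closure B ∩ {x | 0 ≤ crossL (d - b) (x - b)}) :=
      isClosed_closure.inter (isClosed_le (by fun_prop) (by fun_prop))
    obtain ⟨T, h1, h2, h3, h4⟩ := exists_preconnected_around hAo hAc hBc.closure
      hb hd hz hzB (hK.of_isClosed_subset hcl hsub) (hsub.trans hKA')
    exact ⟨T, h2, h3, h4, h1⟩
  rcases hside with hs | hs
  · exact around b d hb hd hbK hdK hzo hs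
  · obtain ⟨T, h1, h2, h3, h4⟩ := around d b hd hb hdK hbK (by rwa [openSegment_symm])
      (fun x hx h => hs x hx (by rw [crossL_swap] at h; linarith))
    exact ⟨T, h1, h3, h2, h4⟩

/-! ### Connectedness of the difference for the actual hulls -/

/-- The open half-plane together with the hull of the contact points is already convex and contains
`S`. -/
theorem convexHull_face {S : Set Plane} (f : Plane →L[ℝ] ℝ) {κ : ℝ} (h : ∀ x ∈ S, f x ≤ κ)
    {y : Plane} (hy : y ∈ convexHull ℝ S) (hfy : f y = κ) :
    y ∈ convexHull ℝ (S ∩ {x | f x = κ}) := by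
  have hface : convexHull ℝ (S ∩ {x | f x = κ}) ⊆ {x | f x = κ} :=
    convexHull_min inter_subset_right ((convex_singleton κ).is_linear_preimage f.isLinear)
  have hQ : Convex ℝ ({x | f x < κ} ∪ convexHull ℝ (S ∩ {x | f x = κ})) := by
    intro x hx y hy s t hs ht hst
    rcases eq_or_lt_of_le hs with rfl | hs'
    · have : t = 1 := by linarith
      subst this; simpa using hy
    rcases eq_or_lt_of_le ht with rfl | ht'
    · have : s = 1 := by linarith
      subst this; simpa using hx
    have hκ : s * κ + t * κ = κ := by rw [← add_mul, hst, one_mul]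
    rcases hx with hx | hx <;> rcases hy with hy | hy
    · left
      have hx' : f x < κ := hx
      have hy' : f y < κ := hy
      change f (s • x + t • y) < κ
      rw [map_add, map_smul, map_smul, smul_eq_mul, smul_eq_mul]
      have h1 := mul_lt_mul_of_pos_left hx' hs'
      have h2 := mul_lt_mul_of_pos_left hy' ht'
      linarith
    · left
      have hx' : f x < κ := hx
      have hy' : f y = κ := hface hy
      change f (s • x + t • y) < κ
      rw [map_add, map_smul, map_smul, smul_eq_mul, smul_eq_mul]
      have h1 := mul_lt_mul_of_pos_left hx' hs'
      rw [hy']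
      linarith
    · left
      have hx' : f x = κ := hface hx
      have hy' : f y < κ := hy
      change f (s • x + t • y) < κ
      rw [map_add, map_smul, map_smul, smul_eq_mul, smul_eq_mul]
      have h2 := mul_lt_mul_of_pos_left hy' ht'
      rw [hx']
      linarith
    · exact Or.inr (convex_convexHull ℝ _ hx hy hs ht hst)
  have hsub : convexHull ℝ S ⊆ {x | f x < κ} ∪ convexHull ℝ (S ∩ {x | f x = κ}) := by
    refine convexHull_min (fun x hx => ?_) hQ
    rcases lt_or_eq_of_le (h x hx) with h' | h'
    · exact Or.inl h'
    · exact Or.inr (subset_convexHull ℝ _ ⟨hx, h'⟩)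
  rcases hsub hy with h' | h'
  · exact absurd hfy (ne_of_lt h')
  · exact h'

/-- A coordinate along the level lines of a nonzero linear functional of the plane. -/
theorem exists_level_coordinate {f : Plane →L[ℝ] ℝ} (hf : f ≠ 0) :
    ∃ (v : Plane) (g : Plane →L[ℝ] ℝ), ∀ x y, f x = f y → x = y + (g x - g y) • v := by
  obtain ⟨v, rfl⟩ := exists_eq_crossL f
  have hv : v ≠ 0 := by
    rintro rfl; apply hf; ext x; simp [crossL_apply]
  obtain ⟨e, he⟩ := exists_crossL_pos hv
  have hev : crossL e v ≠ 0 := by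
    have : crossL e v = -crossL v e := by simp only [crossL_apply]; ring
    rw [this]; linarith
  refine ⟨v, (crossL e v)⁻¹ • crossL e, fun x y hxy => ?_⟩
  obtain ⟨t, ht⟩ := exists_smul_of_crossL_eq_zero hv (x := x - y) (by rw [map_sub, hxy, sub_self])
  have h1 : x = y + t • v := by rw [← ht]; abel
  have h2 : ((crossL e v)⁻¹ • crossL e) x - ((crossL e v)⁻¹ • crossL e) y = t := by
    rw [← map_sub, ht]
    simp only [smul_apply, map_smul, smul_eq_mul]
    field_simp
  rw [h2]; exact h1

theorem mem_segment_of_level_coordinate {f g : Plane →L[ℝ] ℝ} {v : Plane}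
    (hg : ∀ x y, f x = f y → x = y + (g x - g y) • v) {x b y : Plane} (hx : f x = f b)
    (hy : f y = f b) (h1 : g x ≤ g b) (h2 : g b ≤ g y) : b ∈ segment ℝ x y := by
  rcases eq_or_lt_of_le (h1.trans h2) with h | h
  · have : x = b := by
      rw [hg x b hx, show g x - g b = 0 by linarith]; simp
    rw [this]; exact left_mem_segment ℝ _ _
  · have hxe := hg x b hx
    have hye := hg y b hy
    have hpos : 0 < g y - g x := by linarith
    refine ⟨(g y - g b) / (g y - g x), (g b - g x) / (g y - g x), by
      apply div_nonneg <;> linarith, by apply div_nonneg <;> linarith, by field_simp; ring, ?_⟩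
    have e1 : (g y - g b) / (g y - g x) + (g b - g x) / (g y - g x) = 1 := by field_simp; ring
    have e2 : (g y - g b) / (g y - g x) * (g x - g b)
      + (g b - g x) / (g y - g x) * (g y - g b) = 0 := by field_simp; ring
    set p := (g y - g b) / (g y - g x)
    set q := (g b - g x) / (g y - g x)
    linear_combination (norm := module) p • hxe + q • hye + e1 • b + e2 • v

theorem lt_of_isOpen_of_le {A : Set Plane} (hA : IsOpen A) {f : Plane →L[ℝ] ℝ} (hf : f ≠ 0)
    {κ : ℝ} (h : ∀ x ∈ A, f x ≤ κ) : ∀ x ∈ A, f x < κ := by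
  intro x hx
  have ho := f.isOpenMap_of_ne_zero hf A hA
  have hs : f '' A ⊆ interior (Iic κ) := interior_maximal (by rintro _ ⟨y, hy, rfl⟩; exact h y hy) ho
  rw [interior_Iic] at hs
  exact hs ⟨x, hx, rfl⟩

/-- Every point of the closure is the end of a segment in the set. -/
def SegmentAccessible (U : Set Plane) : Prop :=
  ∀ x ∈ closure U, ∃ u ∈ U, openSegment ℝ x u ⊆ U

theorem SegmentAccessible.joinedIn {U : Set Plane} (h : SegmentAccessible U) {x : Plane}
    (hx : x ∈ closure U) : ∃ u ∈ U, JoinedIn (insert x U) x u := by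
  obtain ⟨u, hu, hs⟩ := h x hx
  refine ⟨u, hu, JoinedIn.of_segment_subset ?_⟩
  rw [← insert_endpoints_openSegment]
  rintro z (rfl | rfl | hz)
  · exact Or.inl rfl
  · exact Or.inr hu
  · exact Or.inr (hs hz)

/-- Every point of the difference of the hulls is on a segment in the difference that ends at a
point that can be reached from `U`. -/
theorem exists_segment_reachable {U V : Set Plane} (hU : IsOpen U)
    (hV : IsOpen V) (hVne : V.Nonempty) (hUV : Disjoint U V) (hacc : SegmentAccessible U)
    {b : Plane} (hb : b ∈ convexHull ℝ (closure U) \ convexHull ℝ (closure V)) :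
    ∃ b', segment ℝ b b' ⊆ convexHull ℝ (closure U) \ convexHull ℝ (closure V) ∧
      ReachableAvoiding U V b' := by
  set A := convexHull ℝ U with hA
  set B := convexHull ℝ V with hB
  have hAo : IsOpen A := hU.convexHull
  have hAc : Convex ℝ A := convex_convexHull ℝ U
  have hBD : B ⊆ convexHull ℝ (closure V) := convexHull_mono subset_closure
  have hVB : V ⊆ B := subset_convexHull ℝ V
  obtain ⟨f, hf⟩ := geometric_hahn_banach_open_point (convex_convexHull ℝ V) hV.convexHull
    (fun h => hb.2 (hBD h))
  have hUA : U ⊆ A \ V := fun x hx => ⟨subset_convexHull ℝ U hx, Set.disjoint_left.1 hUV hx⟩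
  -- If `U` has a point beyond the line through `b` that bounds `B`, the segment to this point
  -- avoids `B` and `b` itself is reachable. Otherwise `b` is on a supporting line of `U`.
  by_cases hex : ∃ u ∈ U, f b < f u
  · obtain ⟨u, hu, hfu⟩ := hex
    refine ⟨b, by rw [segment_same]; exact singleton_subset_iff.2 hb, u, hu,
      JoinedIn.of_segment_subset fun x hx => ?_⟩
    have hx' := hAo.segment_subset_insert hAc (hUA hu).1 (convexHull_closure_subset U hb.1)
      (by rwa [segment_symm])
    rcases hx' with rfl | hxA
    · exact Or.inl rfl
    · refine Or.inr ⟨hxA, fun hxV => ?_⟩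
      have : segment ℝ b u ⊆ {x | f b ≤ f x} :=
        ((convex_Ici (f b)).is_linear_preimage f.isLinear).segment_subset (le_refl (f b)) hfu.le
      exact (hf x (hVB hxV)).not_ge (this hx)
  · push Not at hex
    have hle : ∀ x ∈ closure U, f x ≤ f b :=
      fun x hx => closure_minimal (fun y hy => hex y hy) (isClosed_le f.continuous
        continuous_const) hx
    have hbF := convexHull_face f hle hb.1 rfl
    have hf0 : f ≠ 0 := by
      rintro rfl
      obtain ⟨v, hv⟩ := hVne
      simpa using hf v (hVB hv)
    obtain ⟨v, g, hg⟩ := exists_level_coordinate hf0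
    -- On the supporting line, the hull of `closure V` is a convex set without `b`, so it is on one
    -- side of `b`. On the other side (or at `b`) there is a point `p` of `closure U`, and `p` is
    -- accessible.
    have main : ∀ (g' : Plane →L[ℝ] ℝ),
        (∀ x ∈ convexHull ℝ (closure V), f x = f b → g' b < g' x) →
        ∃ b', segment ℝ b b' ⊆ convexHull ℝ (closure U) \ convexHull ℝ (closure V) ∧
          ReachableAvoiding U V b' := by
      intro g' hg'
      obtain ⟨p, ⟨hpU, hpf⟩, hpg⟩ : ∃ p ∈ closure U ∩ {x | f x = f b}, g' p ≤ g' b := by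
        by_contra! h
        have : convexHull ℝ (closure U ∩ {x | f x = f b}) ⊆ {x | g' b < g' x} :=
          convexHull_min h ((convex_Ioi _).is_linear_preimage g'.isLinear)
        exact lt_irrefl (g' b) (this hbF)
      obtain ⟨u, hu, hpu⟩ := hacc.joinedIn hpU
      refine ⟨p, fun x hx => ⟨(convex_convexHull ℝ _).segment_subset hb.1
        (subset_convexHull ℝ _ hpU) hx, fun hxD => ?_⟩, u, hu,
        hpu.mono (insert_subset_insert hUA)⟩
      have h1 : segment ℝ b p ⊆ {x | f x = f b} :=
        ((convex_singleton (f b)).is_linear_preimage f.isLinear).segment_subset rfl hpf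
      have h2 : segment ℝ b p ⊆ {x | g' x ≤ g' b} :=
        ((convex_Iic (g' b)).is_linear_preimage g'.isLinear).segment_subset (le_refl (g' b)) hpg
      exact (hg' x hxD (h1 hx)).not_ge (h2 hx)
    by_cases h1 : ∀ x ∈ convexHull ℝ (closure V), f x = f b → g b < g x
    · exact main g h1
    · push Not at h1
      obtain ⟨x, hxD, hxf, hxg⟩ := h1
      refine main (-g) fun y hyD hyf => ?_
      simp only [neg_apply, neg_lt_neg_iff]
      by_contra! h2
      exact hb.2 ((convex_convexHull ℝ _).segment_subset hxD hyD
        (mem_segment_of_level_coordinate hg hxf hyf hxg h2))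

/-- If the two sets are on the same side of a line, and the hull of one of them separates two
points of the hull of the other one on this line, then the former hull is closed. -/
theorem isClosed_hull_of_separates_on_line {U V : Set Plane} (hU : IsOpen U) (hUc : IsConnected U)
    (hV : IsOpen V) (hVc : IsConnected V) (hUV : Disjoint U V) (haccU : SegmentAccessible U)
    (haccV : SegmentAccessible V) {f : Plane →L[ℝ] ℝ} (hf0 : f ≠ 0) {κ : ℝ}
    (hfU : ∀ x ∈ U, f x < κ) (hfV : ∀ x ∈ V, f x < κ) {b d z : Plane}
    (hb : b ∈ convexHull ℝ (closure U) \ convexHull ℝ (closure V))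
    (hd : d ∈ convexHull ℝ (closure U) \ convexHull ℝ (closure V))
    (hfb : f b = κ) (hfd : f d = κ) (hz : z ∈ segment ℝ b d)
    (hzD : z ∈ convexHull ℝ (closure V)) : IsClosed (convexHull ℝ (closure V)) := by
  obtain ⟨v, g, hg⟩ := exists_level_coordinate hf0
  wlog hbd : g b ≤ g d generalizing b d
  · exact this hd hb hfd hfb (by rwa [segment_symm]) (le_of_not_ge hbd)
  have hDc := convex_convexHull ℝ (closure V)
  have hleU : ∀ x ∈ closure U, f x ≤ κ := fun x hx =>
    closure_minimal (fun y hy => (hfU y hy).le) (isClosed_le f.continuous continuous_const) hx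
  have hleV : ∀ x ∈ closure V, f x ≤ κ := fun x hx =>
    closure_minimal (fun y hy => (hfV y hy).le) (isClosed_le f.continuous continuous_const) hx
  have hfz : f z = κ :=
    ((convex_singleton κ).is_linear_preimage f.isLinear).segment_subset hfb hfd hz
  have hgz1 : g b ≤ g z :=
    ((convex_Ici (g b)).is_linear_preimage g.isLinear).segment_subset (le_refl (g b)) hbd hz
  have hgz2 : g z ≤ g d :=
    ((convex_Iic (g d)).is_linear_preimage g.isLinear).segment_subset hbd (le_refl (g d)) hz
  obtain ⟨q, hqV, hfq⟩ : (closure V ∩ {x | f x = κ}).Nonempty :=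
    convexHull_nonempty_iff.1 ⟨z, convexHull_face f hleV hzD hfz⟩
  have hqD := subset_convexHull ℝ _ hqV
  have hfq : f q = κ := hfq
  have hgq1 : g b < g q := by
    by_contra! h
    exact hb.2 (hDc.segment_subset hqD hzD
      (mem_segment_of_level_coordinate hg (hfq.trans hfb.symm) (hfz.trans hfb.symm) h hgz1))
  have hgq2 : g q < g d := by
    by_contra! h
    exact hd.2 (hDc.segment_subset hzD hqD
      (mem_segment_of_level_coordinate hg (hfz.trans hfd.symm) (hfq.trans hfd.symm) hgz2 h))
  obtain ⟨p₁, ⟨hp₁U, hfp₁⟩, hgp₁⟩ : ∃ p ∈ closure U ∩ {x | f x = κ}, g p ≤ g b := by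
    by_contra! h
    exact lt_irrefl (g b) (convexHull_min h ((convex_Ioi _).is_linear_preimage g.isLinear)
      (convexHull_face f hleU hb.1 hfb))
  obtain ⟨p₂, ⟨hp₂U, hfp₂⟩, hgp₂⟩ : ∃ p ∈ closure U ∩ {x | f x = κ}, g d ≤ g p := by
    by_contra! h
    exact lt_irrefl (g d) (convexHull_min h ((convex_Iio _).is_linear_preimage g.isLinear)
      (convexHull_face f hleU hd.1 hfd))
  have hfp₁ : f p₁ = κ := hfp₁
  have hfp₂ : f p₂ = κ := hfp₂
  have hne₁ : p₁ ≠ q := by rintro rfl; linarith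
  have hne₂ : p₂ ≠ q := by rintro rfl; linarith
  obtain ⟨u₁, hu₁, hj₁⟩ := haccU.joinedIn hp₁U
  obtain ⟨u₂, hu₂, hj₂⟩ := haccU.joinedIn hp₂U
  have hju : JoinedIn U u₁ u₂ := (hU.isConnected_iff_isPathConnected.1 hUc).joinedIn _ hu₁ _ hu₂
  obtain ⟨γ, hγ⟩ : JoinedIn (insert p₁ (insert p₂ U)) p₁ p₂ :=
    ((hj₁.mono (insert_subset_insert (subset_insert _ _))).trans
      (hju.mono ((subset_insert _ _).trans (subset_insert _ _)))).trans
      (hj₂.mono (subset_insert _ _)).symm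
  have hγle : ∀ s, f (γ s) ≤ κ := by
    intro s
    rcases hγ s with h | h | h
    · rw [h, hfp₁]
    · rw [h, hfp₂]
    · exact (hfU _ h).le
  have hKcomp : IsCompact (convexHull ℝ (range γ)) :=
    isCompact_convexHull (isCompact_range γ.continuous)
  have hsub : ∀ s, segment ℝ p₁ (γ s) ⊆ convexHull ℝ (range γ) := fun s =>
    (convex_convexHull ℝ _).segment_subset (subset_convexHull ℝ _ ⟨0, γ.source⟩)
      (subset_convexHull ℝ _ ⟨s, rfl⟩)
  -- The path `γ` runs below the line from `p₁` to `p₂`, and `q`, a limit of points of `V`, is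
  -- between them. If `V` were not enclosed by the hull of `γ`, a path from `q` through `V` to an
  -- outside point `c` would contradict the planar fact. Enclosure makes `V` bounded, hence its
  -- closure compact.
  have hVK : V ⊆ convexHull ℝ (range γ) := by
    intro c hcV
    by_contra hcK
    have hfc := hfV c hcV
    obtain ⟨w, hw, hjq⟩ := haccV.joinedIn hqV
    have hjc : JoinedIn V w c := (hV.isConnected_iff_isPathConnected.1 hVc).joinedIn _ hw _ hcV
    -- The reflection of `c` in `q` is beyond the line, so `a` avoids the hull of `γ`, and the chord
    -- `ac` passes through `q`.
    set a := q + (q - c) with ha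
    have hfa : κ < f a := by rw [ha, map_add, map_sub, hfq]; linarith
    have huniq : ∀ x ∈ segment ℝ c a, f x = κ → x = q := by
      intro x hx hfx
      rw [segment_eq_image'] at hx
      obtain ⟨θ, -, rfl⟩ := hx
      have hac : a - c = (2 : ℝ) • (q - c) := by rw [ha]; module
      simp only at hfx ⊢
      rw [hac, map_add, map_smul, map_smul, map_sub, hfq, smul_eq_mul, smul_eq_mul] at hfx
      have hθ : θ * 2 = 1 := by
        have h0 : (κ - f c) ≠ 0 := by linarith
        have : (θ * 2 - 1) * (κ - f c) = 0 := by linarith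
        rcases mul_eq_zero.1 this with h | h
        · linarith
        · exact absurd h h0
      rw [hac, smul_smul, hθ, one_smul, add_sub_cancel]
    have hqca : q ∈ segment ℝ c a := ⟨1 / 2, 1 / 2, by norm_num, by norm_num, by norm_num, by
      rw [ha]; module⟩
    have hge : ∀ x ∈ segment ℝ a q, κ ≤ f x := fun x hx =>
      ((convex_Ici κ).is_linear_preimage f.isLinear).segment_subset hfa.le hfq.ge hx
    have hsubca : segment ℝ a q ⊆ segment ℝ c a :=
      (convex_segment c a).segment_subset (right_mem_segment ℝ c a) hqca
    obtain ⟨δ, hδ⟩ : JoinedIn (segment ℝ a q ∪ V) a c :=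
      ((JoinedIn.of_segment_subset subset_union_left).trans (hjq.mono (insert_subset
        (Or.inl (right_mem_segment ℝ a q)) subset_union_right))).trans
        (hjc.mono subset_union_right)
    have hnot : ∀ p, p ∈ closure U → f p = κ → p ≠ q → ∀ t, p ∉ segment ℝ c (δ t) := by
      intro p _ hfp hpq t hp
      rcases hδ t with h | h
      · exact hpq (huniq p ((convex_segment c a).segment_subset (left_mem_segment ℝ c a)
          (hsubca h) hp) hfp)
      · exact (hfp.not_lt : ¬ f p < κ) (((convex_Iio κ).is_linear_preimage
          f.isLinear).segment_subset hfc (hfV _ h) hp)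
    have hdis := disjoint_segment_of_disjoint_paths γ δ (fun s t hst => ?_)
      (fun s h => ?_) (fun s h => hcK (hsub s h)) (hnot p₁ hp₁U hfp₁ hne₁)
      (hnot p₂ hp₂U hfp₂ hne₂)
    · refine Set.disjoint_left.1 hdis (mem_segment_of_level_coordinate hg (hfp₁.trans hfq.symm)
        (hfp₂.trans hfq.symm) (by linarith) (by linarith)) (by rwa [segment_symm])
    · have hclV : ∀ x ∈ closure U, x ∉ V := fun x hx =>
        Set.disjoint_left.1 (hUV.closure_left hV) hx
      have hp : ∀ p, p ∈ closure U → f p = κ → p ≠ q → p ≠ δ t := by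
        rintro p hpU hfp hpq rfl
        rcases hδ t with h | h
        · exact hpq (huniq _ (hsubca h) hfp)
        · exact hclV _ hpU h
      rcases hγ s with h | h | h
      · exact hp p₁ hp₁U hfp₁ hne₁ (h ▸ hst)
      · exact hp p₂ hp₂U hfp₂ hne₂ (h ▸ hst)
      · rcases hδ t with h' | h'
        · exact (hge _ h').not_gt (hst ▸ hfU _ h)
        · exact Set.disjoint_left.1 hUV h (hst ▸ h')
    · exact hfa.not_ge (((convex_Iic κ).is_linear_preimage f.isLinear).segment_subset hfp₁.le
        (hγle s) h)
  have hVK' : closure V ⊆ convexHull ℝ (range γ) := closure_minimal hVK hKcomp.isClosed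
  exact (isCompact_convexHull (hKcomp.of_isClosed_subset isClosed_closure hVK')).isClosed

theorem exists_mem_openSegment_of_isOpen {a b : Plane} {N : Set Plane} (hN : IsOpen N)
    (hb : b ∈ N) : ∃ w ∈ openSegment ℝ a b, w ∈ N := by
  have h : b ∈ closure (openSegment ℝ a b) := by
    rw [closure_openSegment]; exact right_mem_segment ℝ a b
  obtain ⟨w, hwN, hw⟩ := mem_closure_iff.1 h N hN hb
  exact ⟨w, hw, hwN⟩

theorem IsPreconnected.exists_mem_frontier {S T : Set Plane} (hS : IsPreconnected S)
    (h1 : (S ∩ T).Nonempty) (h2 : (S ∩ Tᶜ).Nonempty) : (S ∩ frontier T).Nonempty := by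
  by_contra! h
  have hdis : ∀ x ∈ S, x ∈ closure T → x ∈ interior T := fun x hx hxT => by
    by_contra hxi
    exact (h ▸ (⟨hx, hxT, hxi⟩ : x ∈ S ∩ frontier T) : x ∈ (∅ : Set Plane))
  obtain ⟨a, haS, haT⟩ := h1
  obtain ⟨b, hbS, hbT⟩ := h2
  obtain ⟨x, -, hx1, hx2⟩ := hS (interior T) (closure T)ᶜ isOpen_interior
    isClosed_closure.isOpen_compl
    (fun x hx => (em (x ∈ closure T)).imp (hdis x hx) id)
    ⟨a, haS, hdis a haS (subset_closure haT)⟩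
    ⟨b, hbS, fun h => hbT (interior_subset (hdis b hbS h))⟩
  exact hx2 (subset_closure (interior_subset hx1))

/-- Near a point where two supporting lines of an open convex set are different, the set has
boundary points on the positive side of one of them. -/
theorem exists_mem_frontier_near {A N : Set Plane} (hA : IsOpen A) (hAc : Convex ℝ A)
    (hN : IsOpen N) {b d : Plane} (hb : b ∈ closure A) (hbN : b ∈ N) {f h : Plane →L[ℝ] ℝ}
    (hf : ∀ x ∈ A, f x < f b) (hfd : f d < f b) (hh : h ≠ 0) (hhd : h d = h b)
    {a : Plane} (ha : a ∈ A) (hha : h b < h a) : ∃ y ∈ frontier A, y ∈ N ∧ h b < h y := by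
  obtain ⟨r, hr, hball⟩ := Metric.isOpen_iff.1 hN b hbN
  set G := Metric.ball b r ∩ {x | h b < h x} with hG
  have hGp : IsPreconnected G :=
    ((convex_ball b r).inter ((convex_Ioi (h b)).is_linear_preimage h.isLinear)).isPreconnected
  have h1 : (G ∩ A).Nonempty := by
    obtain ⟨w, hw, hwb⟩ := exists_mem_openSegment_of_isOpen (a := a) Metric.isOpen_ball
      (Metric.mem_ball_self (x := b) hr)
    refine ⟨w, ⟨hwb, ?_⟩, hA.openSegment_subset_of_mem_closure hAc ha hb hw⟩
    obtain ⟨s, t, hs, ht, hst, rfl⟩ := hw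
    change h b < h (s • a + t • b)
    have := mul_lt_mul_of_pos_left hha hs
    have h2 : s * h b + t * h b = h b := by rw [← add_mul, hst, one_mul]
    rw [map_add, map_smul, map_smul, smul_eq_mul, smul_eq_mul]
    linarith
  have h2 : (G ∩ Aᶜ).Nonempty := by
    obtain ⟨e₀, he₀⟩ : ∃ e, 0 < h e := by
      obtain ⟨e, he⟩ := DFunLike.ne_iff.1 hh
      rcases lt_or_gt_of_ne he with h' | h'
      · exact ⟨-e, by rw [map_neg]; simpa using h'⟩
      · exact ⟨e, h'⟩
    have hfbd : 0 < f b - f d := by linarith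
    -- The direction `d - b` does not change `h`, so a large multiple of `b - d` makes `f e`
    -- positive too. A small step along `e` then leaves `A` on the positive side of `h`.
    set t := (1 + |f e₀|) / (f b - f d)
    set e := e₀ + t • (b - d) with he
    have hhe : 0 < h e := by
      rw [he, map_add, map_smul, map_sub, hhd, sub_self, smul_zero, add_zero]; exact he₀
    have hfe : 0 < f e := by
      rw [he, map_add, map_smul, map_sub, smul_eq_mul, div_mul_cancel₀ _ hfbd.ne']
      have := neg_abs_le (f e₀); linarith
    have hs : 0 < r / (2 * (‖e‖ + 1)) := by positivity
    refine ⟨b + (r / (2 * (‖e‖ + 1))) • e, ⟨?_, ?_⟩, fun hA' => ?_⟩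
    · rw [Metric.mem_ball, dist_eq_norm, add_sub_cancel_left, norm_smul, Real.norm_of_nonneg hs.le,
        div_mul_eq_mul_div, div_lt_iff₀ (by positivity)]
      have := norm_nonneg e
      nlinarith
    · change h b < h _
      rw [map_add, map_smul, smul_eq_mul]
      have := mul_pos hs hhe; linarith
    · have h3 := hf _ hA'
      rw [map_add, map_smul, smul_eq_mul] at h3
      have := mul_pos hs hfe; linarith
  obtain ⟨y, ⟨hy1, hy2⟩, hy3⟩ := hGp.exists_mem_frontier h1 h2
  exact ⟨y, hy3, hball hy1, hy2⟩

/-- A point of the difference that is not a limit of points of the difference of the open hulls is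
joined to all other reachable points by segments. -/
theorem segment_subset_diff_of_notMem_closure {U V : Set Plane} (hU : IsOpen U)
    (hUc : IsConnected U) (hV : IsOpen V) (hVc : IsConnected V) (hUV : Disjoint U V)
    (haccU : SegmentAccessible U) (haccV : SegmentAccessible V) {b d : Plane}
    (hb : b ∈ convexHull ℝ (closure U) \ convexHull ℝ (closure V))
    (hd : d ∈ convexHull ℝ (closure U) \ convexHull ℝ (closure V))
    (hbr : ReachableAvoiding U V b) (hdr : ReachableAvoiding U V d)
    (hbY : b ∉ closure (convexHull ℝ U \ closure (convexHull ℝ V))) :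
    segment ℝ b d ⊆ convexHull ℝ (closure U) \ convexHull ℝ (closure V) := by
  set A := convexHull ℝ U with hA
  set B := convexHull ℝ V with hB
  have hAo : IsOpen A := hU.convexHull
  have hBo : IsOpen B := hV.convexHull
  have hAc : Convex ℝ A := convex_convexHull ℝ U
  have hBc : Convex ℝ B := convex_convexHull ℝ V
  have hUA : U ⊆ A := subset_convexHull ℝ U
  have hVB : V ⊆ B := subset_convexHull ℝ V
  have hBD : B ⊆ convexHull ℝ (closure V) := convexHull_mono subset_closure
  have hDB : convexHull ℝ (closure V) ⊆ closure B := convexHull_closure_subset V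
  have hbA : b ∈ closure A := convexHull_closure_subset U hb.1
  have hdA : d ∈ closure A := convexHull_closure_subset U hd.1
  have hbB : b ∉ B := fun h => hb.2 (hBD h)
  have hdB : d ∉ B := fun h => hd.2 (hBD h)
  refine fun z hz => ⟨(convex_convexHull ℝ _).segment_subset hb.1 hd.1 hz, fun hzD => ?_⟩
  set N := (closure (A \ closure B))ᶜ with hN
  have hNo : IsOpen N := isClosed_closure.isOpen_compl
  have hNA : A ∩ N ⊆ closure B := fun x hx => by
    by_contra h; exact hx.2 (subset_closure ⟨hx.1, h⟩)
  have hbcl : b ∈ closure B := by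
    by_contra h
    exact hbY (isClosed_closure.isOpen_compl.closure_inter ⟨hbA, h⟩)
  -- A closed hull would contain `b`, so the cases below only have to prove closedness or a
  -- contradiction.
  have hcl : ¬ IsClosed (convexHull ℝ (closure V)) := fun h =>
    hb.2 (closure_minimal hBD h hbcl)
  obtain ⟨f, hf⟩ := geometric_hahn_banach_open_point hBc hBo hbB
  have hf0 : f ≠ 0 := by
    rintro rfl
    obtain ⟨v, hv⟩ := hVc.nonempty
    simpa using hf v (hVB hv)
  have hfcl : ∀ x ∈ closure B, f x ≤ f b := fun x hx =>
    closure_minimal (fun y hy => (hf y hy).le) (isClosed_le f.continuous continuous_const) hx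
  -- Near `b` the set `A` is inside the closure of `B`, so the line supporting `B` at `b` supports
  -- `A` locally, and by convexity globally.
  have hfA : ∀ x ∈ A, f x < f b := by
    refine lt_of_isOpen_of_le hAo hf0 fun x hx => ?_
    obtain ⟨w, hw, hwN⟩ := exists_mem_openSegment_of_isOpen (a := x) hNo hbY
    have hwB := hfcl w (hNA ⟨hAo.openSegment_subset_of_mem_closure hAc hx hbA hw, hwN⟩)
    obtain ⟨s, t, hs, ht, hst, rfl⟩ := hw
    rw [map_add, map_smul, map_smul, smul_eq_mul, smul_eq_mul] at hwB
    have h2 : s * f b + t * f b = f b := by rw [← add_mul, hst, one_mul]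
    exact le_of_mul_le_mul_left (by linarith) hs
  have hfd : f d ≤ f b := closure_minimal (fun y hy => (hfA y hy).le)
    (isClosed_le f.continuous continuous_const) hdA
  rcases eq_or_lt_of_le hfd with hfd | hfd
  · exact hcl (isClosed_hull_of_separates_on_line hU hUc hV hVc hUV haccU haccV hf0
      (fun x hx => hfA x (hUA hx)) (fun x hx => hf x (hVB hx)) hb hd rfl hfd hz hzD)
  · have hzo : z ∈ openSegment ℝ b d := mem_openSegment_of_mem_segment hz
      (by rintro rfl; exact hb.2 hzD) (by rintro rfl; exact hd.2 hzD)
    obtain ⟨K, hK, hbK, hdK, hKc, hKA, hside⟩ := exists_blocking_side hU hUc hV hVc hUV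
      hbr hdr hbB hdB hbA hdA hzo (hDB hzD)
    have hbd : d - b ≠ 0 := by
      intro h; rw [sub_eq_zero.1 h] at hfd; exact lt_irrefl _ hfd
    have key : ∀ v : Plane, v ≠ 0 → crossL v (d - b) = 0 →
        (∀ x ∈ B, 0 < crossL v (x - b) → x ∈ K) → False := by
      intro v hv hvd hvK
      have hv0 : crossL v ≠ 0 := by
        obtain ⟨e, he⟩ := exists_crossL_pos hv
        intro h; rw [h] at he; simp at he
      have hvdb : crossL v d = crossL v b := by rw [map_sub] at hvd; linarith
      have hvseg : ∀ x ∈ segment ℝ b d, crossL v x = crossL v b := fun x hx =>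
        ((convex_singleton (crossL v b)).is_linear_preimage (crossL v).isLinear).segment_subset
          rfl hvdb hx
      -- If `A` has points on the blocked side, it has boundary points there near `b`. They are in
      -- the closure of `B`, hence in `K`, which is impossible since `K` is inside `A` and the
      -- chord. If not, both sets are on one side of the line `bd`.
      by_cases hex : ∃ a ∈ A, crossL v b < crossL v a
      · obtain ⟨a, ha, hva⟩ := hex
        obtain ⟨y, hyA, hyN, hy⟩ := exists_mem_frontier_near hAo hAc hNo hbA hbY hfA hfd hv0 hvdb
          ha hva
        rw [hAo.frontier_eq] at hyA
        have hyB : y ∈ closure B := by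
          have := hNo.closure_inter ⟨hyA.1, hyN⟩
          exact closure_minimal hNA isClosed_closure this
        have hyK := closure_inter_halfPlane_subset hK.isClosed v b hvK hyB
          (by rw [map_sub]; linarith)
        rcases hKA hyK with h | h
        · exact hyA.2 h
        · exact hy.ne' (hvseg y h)
      · push Not at hex
        have h1 := lt_of_isOpen_of_le hAo hv0 hex
        have h2 : ∀ x ∈ B, crossL v x < crossL v b := by
          refine lt_of_isOpen_of_le hBo hv0 fun x hx => ?_
          by_contra! h
          rcases hKA (hvK x hx (by rw [map_sub]; linarith)) with h' | h'
          · exact (hex x h').not_gt h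
          · exact h.ne' (hvseg x h')
        exact hcl (isClosed_hull_of_separates_on_line hU hUc hV hVc hUV haccU haccV hv0
          (fun x hx => h1 x (hUA hx)) (fun x hx => h2 x (hVB hx)) hb hd rfl hvdb hz hzD)
    rcases hside with hs | hs
    · exact key (d - b) hbd (crossL_self _) hs
    · have hneg : ∀ x, crossL (b - d) x = -crossL (d - b) x := fun x => by
        simp only [crossL_apply, PiLp.sub_apply]; ring
      exact key (b - d) (by rw [← neg_sub]; exact neg_ne_zero.2 hbd) (by rw [hneg]; simp)
        (fun x hx h => hs x hx (by rw [hneg] at h; linarith))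

/-- Every point is first moved to a reachable one. Reachable points in the closure of the connected
open difference can be added to it; any other reachable point sees all reachable points along
segments. -/
theorem isPreconnected_hull_diff_hull {U V : Set Plane} (hU : IsOpen U)
    (hUc : IsConnected U) (hV : IsOpen V) (hVc : IsConnected V) (hUV : Disjoint U V)
    (haccU : SegmentAccessible U) (haccV : SegmentAccessible V) :
    IsPreconnected (convexHull ℝ (closure U) \ convexHull ℝ (closure V)) := by
  set CD := convexHull ℝ (closure U) \ convexHull ℝ (closure V) with hCD
  have hY : convexHull ℝ U \ closure (convexHull ℝ V) ⊆ CD :=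
    sdiff_subset_sdiff (convexHull_mono subset_closure) (convexHull_closure_subset V)
  have core : ∀ b ∈ CD, ∀ d ∈ CD, ReachableAvoiding U V b → ReachableAvoiding U V d →
      ∃ T ⊆ CD, b ∈ T ∧ d ∈ T ∧ IsPreconnected T := by
    intro b hb d hd hbr hdr
    by_cases hbY : b ∈ closure (convexHull ℝ U \ closure (convexHull ℝ V))
    · by_cases hdY : d ∈ closure (convexHull ℝ U \ closure (convexHull ℝ V))
      · refine ⟨insert b (insert d (convexHull ℝ U \ closure (convexHull ℝ V))),
          insert_subset hb (insert_subset hd hY), Or.inl rfl, Or.inr (Or.inl rfl), ?_⟩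
        exact (isPreconnected_hull_diff_closure hU hUc hV hVc hUV).subset_closure
          ((subset_insert _ _).trans (subset_insert _ _))
          (insert_subset hbY (insert_subset hdY subset_closure))
      · exact ⟨segment ℝ d b, segment_subset_diff_of_notMem_closure hU hUc hV hVc hUV haccU haccV
          hd hb hdr hbr hdY, right_mem_segment ℝ _ _, left_mem_segment ℝ _ _,
          (convex_segment _ _).isPreconnected⟩
    · exact ⟨segment ℝ b d, segment_subset_diff_of_notMem_closure hU hUc hV hVc hUV haccU haccV
        hb hd hbr hdr hbY, left_mem_segment ℝ _ _, right_mem_segment ℝ _ _,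
        (convex_segment _ _).isPreconnected⟩
  refine isPreconnected_of_forall_pair fun b hb d hd => ?_
  obtain ⟨b', hbs, hbr⟩ := exists_segment_reachable hU hV hVc.nonempty hUV haccU hb
  obtain ⟨d', hds, hdr⟩ := exists_segment_reachable hU hV hVc.nonempty hUV haccU hd
  obtain ⟨T, hT, hbT, hdT, hTp⟩ := core b' (hbs (right_mem_segment ℝ _ _)) d'
    (hds (right_mem_segment ℝ _ _)) hbr hdr
  refine ⟨(segment ℝ b b' ∪ T) ∪ segment ℝ d d', union_subset (union_subset hbs hT) hds,
    Or.inl (Or.inl (left_mem_segment ℝ _ _)), Or.inr (left_mem_segment ℝ _ _), ?_⟩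
  exact ((convex_segment b b').isPreconnected.union b' (right_mem_segment ℝ _ _) hbT hTp).union d'
    (Or.inr hdT) (right_mem_segment ℝ _ _) (convex_segment d d').isPreconnected

/-! ### A separating line and the number of crossings -/

/-- A combination with positive weights of three affinely independent points is interior to their
triangle, so at a boundary point Carathéodory needs at most two points. -/
theorem exists_mem_segment_of_notMem_interior {S : Set Plane} {y : Plane}
    (hy : y ∈ convexHull ℝ S) (hyi : y ∉ interior (convexHull ℝ S)) :
    ∃ a ∈ S, ∃ c ∈ S, y ∈ segment ℝ a c := by
  classical
  obtain ⟨ι, _, z, w, hz, hind, hw, hw1, hy'⟩ := eq_pos_convex_span_of_mem_convexHull hy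
  have hcard : Fintype.card ι ≤ 3 := by
    have := hind.card_le_finrank_succ
    have h2 := Submodule.finrank_le (vectorSpan ℝ (range z))
    rw [finrank_euclideanSpace_fin] at h2
    omega
  rcases hcard.lt_or_eq with hlt | h3
  · set t := Finset.univ.image z with ht
    have htc : t.card < 3 := Finset.card_image_le.trans_lt (by simpa using hlt)
    have hyt : y ∈ convexHull ℝ (t : Set Plane) := by
      rw [← hy']
      exact (convex_convexHull ℝ _).sum_mem (fun i _ => (hw i).le) hw1
        (fun i _ => subset_convexHull ℝ _ (by simp [ht]))
    have hts : (t : Set Plane) ⊆ S := by simpa [ht] using hz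
    have hne : t.card ≠ 0 := by
      rw [Ne, Finset.card_eq_zero]; intro h; rw [h] at hyt; simp at hyt
    have : t.card = 1 ∨ t.card = 2 := by omega
    rcases this with h | h
    · obtain ⟨a, hta⟩ := Finset.card_eq_one.1 h
      rw [hta] at hts hyt
      simp at hts hyt
      exact ⟨a, hts, a, hts, by simpa⟩
    · obtain ⟨a, c, -, hta⟩ := Finset.card_eq_two.1 h
      rw [hta] at hts hyt
      simp only [Finset.coe_insert, Finset.coe_singleton, insert_subset_iff,
        singleton_subset_iff, convexHull_pair] at hts hyt
      exact ⟨a, hts.1, c, hts.2, hyt⟩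
  · exfalso
    have htop : affineSpan ℝ (range z) = ⊤ := by
      rw [hind.affineSpan_eq_top_iff_card_eq_finrank_add_one, finrank_euclideanSpace_fin, h3]
    let B : AffineBasis ι ℝ Plane := ⟨z, hind, htop⟩
    have hB := B.interior_convexHull
    refine hyi (interior_mono (convexHull_mono hz) (?_ : y ∈ interior (convexHull ℝ (range B))))
    rw [hB]
    intro i
    have hcomb : y = Finset.univ.affineCombination ℝ B w := by
      rw [Finset.affineCombination_eq_linear_combination _ _ _ hw1]; exact hy'.symm
    rw [hcomb, B.coord_apply_combination_of_mem (Finset.mem_univ i) hw1]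
    exact hw i

/-- The hull of `S` need not be closed, so the exit point is taken from the hull of a finite subset
that contains `z` in its hull. -/
theorem exists_mem_segment_of_exit {S : Set Plane} {z b : Plane} (hz : z ∈ convexHull ℝ S)
    (hb : b ∉ convexHull ℝ S) :
    ∃ y ∈ segment ℝ z b, ∃ a ∈ S, ∃ c ∈ S, y ∈ segment ℝ a c := by
  obtain ⟨t, htS, hzt, -, -⟩ := exists_affineIndependent_of_mem_convexHull hz
  obtain ⟨y, hys, hyf⟩ := (convex_segment z b).isPreconnected.exists_mem_frontier
    (T := convexHull ℝ (t : Set Plane)) ⟨z, left_mem_segment ℝ _ _, hzt⟩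
    ⟨b, right_mem_segment ℝ _ _, fun h => hb (convexHull_mono htS h)⟩
  have hcl : IsClosed (convexHull ℝ (t : Set Plane)) := t.finite_toSet.isClosed_convexHull ℝ
  rw [hcl.frontier_eq] at hyf
  obtain ⟨a, ha, c, hc, hyac⟩ := exists_mem_segment_of_notMem_interior hyf.1 hyf.2
  exact ⟨y, hys, a, htS ha, c, htS hc, hyac⟩

/-- The differences of the hulls of disjoint connected open sets are separated by a line. -/
theorem exists_separating_line {U V : Set Plane} (hU : IsOpen U)
    (hUc : IsConnected U) (hV : IsOpen V) (hVc : IsConnected V) (hUV : Disjoint U V)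
    (hX : (convexHull ℝ V \ closure (convexHull ℝ U)).Nonempty) :
    ∃ (f : Plane →L[ℝ] ℝ) (κ : ℝ),
      (∀ x ∈ convexHull ℝ V \ closure (convexHull ℝ U), f x < κ) ∧
      ∀ x ∈ convexHull ℝ U \ closure (convexHull ℝ V), κ < f x := by
  set A := convexHull ℝ U with hA
  set B := convexHull ℝ V with hB
  have hAc : Convex ℝ A := convex_convexHull ℝ U
  have hBc : Convex ℝ B := convex_convexHull ℝ V
  have hAo : IsOpen A := hU.convexHull
  have hBo : IsOpen B := hV.convexHull
  set X := B \ closure A with hXd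
  set Y := A \ closure B with hYd
  have hXo : IsOpen X := hBo.sdiff isClosed_closure
  have hYo : IsOpen Y := hAo.sdiff isClosed_closure
  have chord : ∀ b ∈ Y, ∀ d ∈ Y, ∀ a ∈ X, ∀ c ∈ X,
      Disjoint (segment ℝ b d) (segment ℝ a c) := by
    intro b hb d hd a ha c hc
    obtain ⟨K, -, -, -, -, hKA, hK⟩ := exists_blocking_set hU hUc hV hVc hUV
      (reachableAvoiding_of_notMem_closure hb.1 hb.2)
      (reachableAvoiding_of_notMem_closure hd.1 hd.2)
      (fun h => hb.2 (subset_closure h)) (fun h => hd.2 (subset_closure h)) (subset_closure hb.1)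
      (subset_closure hd.1)
    have hKA' : K ⊆ closure A :=
      (hKA.trans (union_subset subset_rfl (hAc.segment_subset hb.1 hd.1))).trans subset_closure
    exact hK a ⟨ha.1, fun h => ha.2 (hKA' h)⟩ c ⟨hc.1, fun h => hc.2 (hKA' h)⟩
  have hXB : convexHull ℝ X ⊆ B := convexHull_min sdiff_subset hBc
  have hYA : convexHull ℝ Y ⊆ A := convexHull_min sdiff_subset hAc
  -- The passage from chords to hulls is made one set at a time: a chord that enters a hull leaves
  -- it through a chord of that hull.
  have step : ∀ b ∈ Y, ∀ d ∈ Y, Disjoint (segment ℝ b d) (convexHull ℝ X) := by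
    intro b hb d hd
    rw [Set.disjoint_left]
    intro z hz hzX
    obtain ⟨y, hy, a, ha, c, hc, hyac⟩ := exists_mem_segment_of_exit hzX
      (fun h => hb.2 (subset_closure (hXB h)))
    exact Set.disjoint_left.1 (chord b hb d hd a ha c hc)
      ((convex_segment b d).segment_subset hz (left_mem_segment ℝ b d) hy) hyac
  have hdis : Disjoint (convexHull ℝ X) (convexHull ℝ Y) := by
    rw [Set.disjoint_left]
    intro z hzX hzY
    obtain ⟨a, ha⟩ := hX
    obtain ⟨y, hy, b, hb, d, hd, hybd⟩ := exists_mem_segment_of_exit hzY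
      (fun h => ha.2 (subset_closure (hYA h)))
    exact Set.disjoint_left.1 (step b hb d hd) hybd
      ((convex_convexHull ℝ X).segment_subset hzX (subset_convexHull ℝ X ha) hy)
  obtain ⟨f, κ, h1, h2⟩ := geometric_hahn_banach_open_open (convex_convexHull ℝ X)
    hXo.convexHull (convex_convexHull ℝ Y) hYo.convexHull hdis
  exact ⟨f, κ, fun x hx => h1 x (subset_convexHull ℝ X hx),
    fun x hx => h2 x (subset_convexHull ℝ Y hx)⟩

/-- A line through a point of an open convex set contains at most two boundary points. -/
theorem encard_line_inter_frontier_le {W : Set Plane} (hW : IsOpen W) (hWc : Convex ℝ W)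
    {f : Plane →L[ℝ] ℝ} (hf : f ≠ 0) {o : Plane} (ho : o ∈ W) :
    ({x | f x = f o} ∩ frontier W).encard ≤ 2 := by
  obtain ⟨v, g, hg⟩ := exists_level_coordinate hf
  rw [hW.frontier_eq]
  have key : ∀ g' : Plane →L[ℝ] ℝ, (∀ x y, f x = f y → ∃ w : Plane, x = y + (g' x - g' y) • w) →
      (∀ x y, f x = f o → f y = f o → g' o < g' x → g' x < g' y → x ∈ segment ℝ o y) →
      ({x | f x = f o ∧ g' o < g' x} ∩ (closure W \ W)).Subsingleton := by
    rintro g' hg' hs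
    have aux : ∀ x y, f x = f o → f y = f o → g' o < g' x → x ∉ W → y ∈ closure W →
        ¬ g' x < g' y := by
      intro x y hx hy h1 hxW hyW h2
      refine hxW (hW.openSegment_subset_of_mem_closure hWc ho hyW
        (mem_openSegment_of_mem_segment (hs x y hx hy h1 h2) ?_ ?_))
      · rintro rfl; exact hxW ho
      · rintro rfl; exact lt_irrefl _ h2
    rintro x ⟨⟨hx, hxo⟩, hx1, hx2⟩ y ⟨⟨hy, hyo⟩, hy1, hy2⟩
    have h1 := aux x y hx hy hxo hx2 hy1
    have h2 := aux y x hy hx hyo hy2 hx1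
    obtain ⟨w, hw⟩ := hg' x y (hx.trans hy.symm)
    rw [hw, show g' x - g' y = 0 by linarith]; simp
  have h1 := key g (fun x y h => ⟨v, hg x y h⟩) (fun x y hx hy h1 h2 =>
    mem_segment_of_level_coordinate hg hx.symm (hy.trans hx.symm) h1.le h2.le)
  have h2 := key (-g) (fun x y h => ⟨-v, by
      rw [neg_apply, neg_apply, smul_neg, ← neg_smul]
      convert hg x y h using 3; ring⟩) (fun x y hx hy h1 h2 => by
    simp only [neg_apply, neg_lt_neg_iff] at h1 h2
    rw [segment_symm]
    exact mem_segment_of_level_coordinate hg (hy.trans hx.symm) hx.symm h2.le h1.le)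
  have hsub : {x | f x = f o} ∩ (closure W \ W) ⊆
      ({x | f x = f o ∧ g o < g x} ∩ (closure W \ W)) ∪
      ({x | f x = f o ∧ (-g) o < (-g) x} ∩ (closure W \ W)) := by
    rintro x ⟨hx, hxW⟩
    have hx : f x = f o := hx
    rcases lt_trichotomy (g o) (g x) with h | h | h
    · exact Or.inl ⟨⟨hx, h⟩, hxW⟩
    · exfalso
      have : x = o := by rw [hg x o hx, h]; simp
      exact hxW.2 (this ▸ ho)
    · exact Or.inr ⟨⟨hx, by simpa using h⟩, hxW⟩
  calc _ ≤ _ := encard_le_encard hsub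
    _ ≤ _ := encard_union_le _ _
    _ ≤ 1 + 1 := add_le_add (encard_le_one_iff_subsingleton.2 h1)
        (encard_le_one_iff_subsingleton.2 h2)
    _ = 2 := one_add_one_eq_two

/-- The boundary of `A` inside `B` is on one closed side of the separating line, and the part off
the closure of `B` on the other. A crossing inside an open half-plane would have a neighbourhood
without one of the two kinds, so every crossing meets the line, and distinct components meet it in
distinct points. -/
theorem encard_boundaryCrossings_le {U V C D : Set Plane} (hU : IsOpen U)
    (hUc : IsConnected U) (hV : IsOpen V) (hVc : IsConnected V) (hUV : Disjoint U V)
    (hC : frontier C = frontier (convexHull ℝ U)) (hD : frontier D = frontier (convexHull ℝ V))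
    (hDi : interior D = convexHull ℝ V) (hDc : closure D = closure (convexHull ℝ V)) :
    (boundaryCrossings C D).encard ≤ 2 := by
  rcases (boundaryCrossings C D).eq_empty_or_nonempty with hemp | ⟨K₀, -, hK₀⟩
  · rw [hemp]; simp
  set A := convexHull ℝ U with hA
  set B := convexHull ℝ V with hB
  have hAc : Convex ℝ A := convex_convexHull ℝ U
  have hBc : Convex ℝ B := convex_convexHull ℝ V
  have hAo : IsOpen A := hU.convexHull
  have hBo : IsOpen B := hV.convexHull
  rw [hC, hDi, hDc] at hK₀
  obtain ⟨⟨x₀, -, hx₀⟩, ⟨y₀, -, hy₀⟩⟩ := hK₀ univ isOpen_univ (subset_univ _)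
  have hXcl : frontier A ∩ B ⊆ closure (B \ closure A) := by
    rintro x ⟨hxA, hxB⟩
    rw [hAo.frontier_eq] at hxA
    have : x ∈ closure (closure A)ᶜ := by
      rw [closure_compl, hAo.interior_closure_of_convex hAc]; exact hxA.2
    have := hBo.closure_inter ⟨this, hxB⟩
    rwa [inter_comm] at this
  have hYcl : frontier A \ closure B ⊆ closure (A \ closure B) := by
    rintro x ⟨hxA, hxB⟩
    exact isClosed_closure.isOpen_compl.closure_inter ⟨frontier_subset_closure hxA, hxB⟩
  obtain ⟨x₁, hx₁⟩ := closure_nonempty_iff.1 ⟨x₀, hXcl hx₀⟩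
  obtain ⟨y₁, hy₁⟩ := closure_nonempty_iff.1 ⟨y₀, hYcl hy₀⟩
  obtain ⟨f, κ, hfX, hfY⟩ := exists_separating_line hU hUc hV hVc hUV ⟨x₁, hx₁⟩
  have hf0 : f ≠ 0 := by
    rintro rfl
    have h1 := hfX x₁ hx₁
    have h2 := hfY y₁ hy₁
    simp only [zero_apply] at h1 h2
    exact lt_asymm h1 h2
  have hX : ∀ x ∈ frontier A ∩ B, f x ≤ κ := fun x hx =>
    closure_minimal (fun y hy => (hfX y hy).le) (isClosed_le f.continuous continuous_const)
      (hXcl hx)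
  have hY : ∀ x ∈ frontier A \ closure B, κ ≤ f x := fun x hx =>
    closure_minimal (fun y hy => (hfY y hy).le) (isClosed_le continuous_const f.continuous)
      (hYcl hx)
  have hmeet : ∀ K ∈ boundaryCrossings C D, ∃ p ∈ K, f p = κ := by
    rintro K ⟨⟨x, hx, hKx⟩, hK⟩
    rw [hC, hDi, hDc] at hK
    have hKp : IsPreconnected K := hKx ▸ isPreconnected_connectedComponentIn
    have hxK : x ∈ K := hKx ▸ mem_connectedComponentIn hx
    by_contra! hne
    have hlt : ¬ K ⊆ {x | f x < κ} := fun h => by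
      obtain ⟨-, y, hy1, hy2⟩ := hK _ (isOpen_lt f.continuous continuous_const) h
      exact (hY y hy2).not_gt hy1
    have hgt : ¬ K ⊆ {x | κ < f x} := fun h => by
      obtain ⟨⟨y, hy1, hy2⟩, -⟩ := hK _ (isOpen_lt continuous_const f.continuous) h
      exact (hX y hy2).not_gt hy1
    obtain ⟨p, hpK, hp⟩ := not_subset.1 hlt
    obtain ⟨q, hqK, hq⟩ := not_subset.1 hgt
    have himg := hKp.image f f.continuous.continuousOn
    obtain ⟨r, hrK, hr⟩ := himg.Icc_subset ⟨q, hqK, rfl⟩ ⟨p, hpK, rfl⟩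
      (⟨not_lt.1 hq, not_lt.1 hp⟩ : κ ∈ Icc (f q) (f p))
    exact hne r hrK hr
  have hfin : ({x | f x = κ} ∩ (frontier A ∩ frontier B)).encard ≤ 2 := by
    by_cases hoA : ∃ o ∈ A, f o = κ
    · obtain ⟨o, ho, rfl⟩ := hoA
      exact (encard_le_encard (inter_subset_inter_right _ inter_subset_left)).trans
        (encard_line_inter_frontier_le hAo hAc hf0 ho)
    -- If the line misses `A`, then `A` is above it, so `x₀`, a boundary point of `A` inside `B`, is
    -- on the line. Thus the line passes through `B` instead.
    · push Not at hoA
      have hApos : ∀ x ∈ A, κ < f x := by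
        intro x hx
        by_contra! hle
        obtain ⟨r, hrA, hr⟩ := (hAc.isPreconnected.image f f.continuous.continuousOn).Icc_subset
          ⟨x, hx, rfl⟩ ⟨y₁, hy₁.1, rfl⟩ (⟨hle, (hfY y₁ hy₁).le⟩ : κ ∈ Icc (f x) (f y₁))
        exact hoA r hrA hr
      have h1 : κ ≤ f x₀ := closure_minimal (fun y hy => (hApos y hy).le)
        (isClosed_le continuous_const f.continuous) (frontier_subset_closure hx₀.1)
      have h2 : f x₀ = κ := le_antisymm (hX x₀ hx₀) h1
      rw [← h2]
      exact (encard_le_encard (inter_subset_inter_right _ inter_subset_right)).trans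
        (encard_line_inter_frontier_le hBo hBc hf0 hx₀.2)
  choose! p hpK hpf using hmeet
  have hcomp : ∀ K ∈ boundaryCrossings C D, p K ∈ frontier C ∩ frontier D ∧
      K = connectedComponentIn (frontier C ∩ frontier D) (p K) := by
    intro K hK
    have h1 := hpK K hK
    obtain ⟨⟨x, -, hKx⟩, -⟩ := hK
    have h1' : p K ∈ connectedComponentIn (frontier C ∩ frontier D) x := hKx ▸ h1
    exact ⟨connectedComponentIn_subset _ _ h1', hKx.trans (connectedComponentIn_eq h1')⟩
  have hmaps : MapsTo p (boundaryCrossings C D)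
      ({x | f x = κ} ∩ (frontier A ∩ frontier B)) := fun K hK =>
    ⟨hpf K hK, by rw [← hC, ← hD]; exact (hcomp K hK).1⟩
  have hinj : InjOn p (boundaryCrossings C D) := fun K hK K' hK' heq => by
    rw [(hcomp K hK).2, (hcomp K' hK').2, heq]
  exact (encard_le_encard_of_injOn hmaps hinj).trans hfin

/-! ### Boundaries with finitely many common points -/

/-- Inside every neighbourhood of a boundary point an open convex set has infinitely many boundary
points. -/
theorem infinite_frontier_inter {A N : Set Plane} (hA : IsOpen A) (hAc : Convex ℝ A)
    (hN : IsOpen N) {p : Plane} (hpA : p ∈ frontier A) (hpN : p ∈ N) :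
    (frontier A ∩ N).Infinite := by
  intro hfin
  obtain ⟨r, hr, hball⟩ := Metric.isOpen_iff.1 hN p hpN
  -- A ball is a copy of the plane, and the plane stays connected after removal of a countable set.
  -- So finitely many boundary points cannot separate `A` from the complement of its closure in the
  -- ball.
  set φ := OpenPartialHomeomorph.univBall p r
  have hφc : Continuous φ := OpenPartialHomeomorph.continuous_univBall p r
  have hsrc : φ.source = univ := OpenPartialHomeomorph.univBall_source p r
  have htgt : φ.target = Metric.ball p r := OpenPartialHomeomorph.univBall_target p hr
  have hinj : InjOn φ univ := hsrc ▸ φ.injOn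
  set T := φ ⁻¹' (frontier A ∩ N) with hT
  have hTc : T.Countable := (hfin.preimage (hinj.mono (subset_univ _))).countable
  have hrank : 1 < Module.rank ℝ Plane := by
    rw [← Module.finrank_eq_rank, finrank_euclideanSpace_fin]; norm_num
  have hG : IsPreconnected (φ '' Tᶜ) :=
    (hTc.isConnected_compl_of_one_lt_rank hrank).isPreconnected.image φ hφc.continuousOn
  have hmeet : ∀ O : Set Plane, IsOpen O → p ∈ closure O → (φ '' Tᶜ ∩ O).Nonempty := by
    intro O hO hpO
    obtain ⟨x, hxb, hxO⟩ := mem_closure_iff.1 hpO _ Metric.isOpen_ball (Metric.mem_ball_self hr)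
    have hpre : (φ ⁻¹' O).Nonempty :=
      ⟨φ.symm x, by rw [mem_preimage, φ.right_inv (htgt ▸ hxb)]; exact hxO⟩
    obtain ⟨w, hwO, hwT⟩ := (hTc.dense_compl ℝ).inter_open_nonempty _ (hO.preimage hφc) hpre
    exact ⟨φ w, ⟨w, hwT, rfl⟩, hwO⟩
  have h1 := hmeet A hA (frontier_subset_closure hpA)
  have h2 := hmeet (closure A)ᶜ isClosed_closure.isOpen_compl (by
    rw [closure_compl, hA.interior_closure_of_convex hAc]
    rw [hA.frontier_eq] at hpA; exact hpA.2)
  obtain ⟨-, ⟨w, hwT, rfl⟩, hwA⟩ := hG.exists_mem_frontier h1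
    (h2.mono (inter_subset_inter_right _ (compl_subset_compl.2 subset_closure)))
  refine hwT ⟨hwA, hball (htgt ▸ φ.map_source (hsrc ▸ mem_univ w))⟩

/-- `b` and `x₃` are on different sides of the line through `x₁` and `x₂`. -/
def BeyondEdge (x₁ x₂ x₃ b : Plane) : Prop :=
  crossL (x₂ - x₁) (b - x₁) * crossL (x₂ - x₁) (x₃ - x₁) < 0

theorem BeyondEdge.swap {x₁ x₂ x₃ b : Plane} (h : BeyondEdge x₁ x₂ x₃ b) :
    BeyondEdge x₂ x₁ x₃ b := by
  unfold BeyondEdge at *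
  rw [crossL_swap x₁ x₂, crossL_swap x₁ x₂]
  linarith

/-- Cramer's rule. -/
theorem exists_combination_of_crossL_ne_zero {u v : Plane} (h : crossL u v ≠ 0) (x : Plane) :
    ∃ s t : ℝ, x = s • u + t • v := by
  refine ⟨crossL x v / crossL u v, crossL u x / crossL u v, ?_⟩
  have hx : crossL u v • x = crossL x v • u + crossL u x • v := by
    ext i
    fin_cases i <;> simp [crossL_apply] <;> ring
  rw [div_eq_inv_mul, div_eq_inv_mul, mul_smul, mul_smul, ← smul_add, ← hx, smul_smul,
    inv_mul_cancel₀ h, one_smul]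

theorem combo_mem_of_isOpen {A : Set Plane} (hA : IsOpen A) (hAc : Convex ℝ A) {p y y' : Plane}
    (hp : p ∈ A) (hy : y ∈ closure A) (hy' : y' ∈ closure A) {s t r : ℝ} (hs : 0 < s)
    (ht : 0 ≤ t) (hr : 0 ≤ r) (hsum : s + t + r = 1) : s • p + t • y + r • y' ∈ A := by
  have h2 : ∀ p ∈ A, ∀ y ∈ closure A, ∀ s t : ℝ, 0 < s → 0 ≤ t → s + t = 1 →
      s • p + t • y ∈ A := fun p hp y hy s t hs ht hst => by
    have := hAc.combo_interior_closure_mem_interior (hA.interior_eq.symm ▸ hp) hy hs ht hst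
    rwa [hA.interior_eq] at this
  have hst : 0 < s + t := by linarith
  have h1 := h2 p hp y hy (s / (s + t)) (t / (s + t)) (by positivity) (by positivity)
    (by rw [← add_div, div_self hst.ne'])
  have h3 := h2 _ h1 y' hy' (s + t) r hst hr hsum
  rwa [smul_add, smul_smul, smul_smul, mul_div_cancel₀ _ hst.ne', mul_div_cancel₀ _ hst.ne'] at h3

/-- The hull of `U` does not leave the hull of `V` across two of the edges of a triangle of common
boundary points. -/
theorem not_beyondEdge_beyondEdge {U V : Set Plane} (hU : IsOpen U)
    (hUc : IsConnected U) (hV : IsOpen V) (hVc : IsConnected V) (hUV : Disjoint U V)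
    {x₁ x₂ x₃ b d : Plane}
    (h₁ : x₁ ∈ frontier (convexHull ℝ U) ∩ frontier (convexHull ℝ V))
    (h₂ : x₂ ∈ frontier (convexHull ℝ U) ∩ frontier (convexHull ℝ V))
    (h₃ : x₃ ∈ frontier (convexHull ℝ U) ∩ frontier (convexHull ℝ V))
    (hb : b ∈ convexHull ℝ U \ closure (convexHull ℝ V))
    (hd : d ∈ convexHull ℝ U \ closure (convexHull ℝ V))
    (hbe : BeyondEdge x₁ x₂ x₃ b) (hde : BeyondEdge x₁ x₃ x₂ d) : False := by
  set A := convexHull ℝ U with hA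
  set B := convexHull ℝ V with hB
  have hAc : Convex ℝ A := convex_convexHull ℝ U
  have hBc : Convex ℝ B := convex_convexHull ℝ V
  have hAo : IsOpen A := hU.convexHull
  rw [hAo.frontier_eq] at h₁ h₂ h₃
  unfold BeyondEdge at hbe hde
  set e₂ := x₂ - x₁ with he₂
  set e₃ := x₃ - x₁ with he₃
  have hanti : crossL e₃ e₂ = -crossL e₂ e₃ := by simp only [crossL_apply]; ring
  set Δ := crossL e₂ e₃ with hΔ
  have hΔ0 : Δ ≠ 0 := by intro h; rw [h] at hbe; simp at hbe
  have hΔpos : 0 < Δ * Δ := mul_self_pos.2 hΔ0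
  obtain ⟨β₂, β₃, hβ⟩ := exists_combination_of_crossL_ne_zero hΔ0 (b - x₁)
  obtain ⟨δ₂, δ₃, hδ⟩ := exists_combination_of_crossL_ne_zero hΔ0 (d - x₁)
  have hβ₃ : β₃ < 0 := by
    rw [hβ, map_add, map_smul, map_smul, crossL_self, smul_zero, zero_add, smul_eq_mul] at hbe
    by_contra! h
    have := mul_nonneg h hΔpos.le
    change β₃ * Δ * Δ < 0 at hbe
    linarith
  have hδ₂ : δ₂ < 0 := by
    rw [hδ, map_add, map_smul, map_smul, crossL_self, smul_zero, add_zero, smul_eq_mul,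
      hanti] at hde
    by_contra! h
    have := mul_nonneg h hΔpos.le
    change δ₂ * -Δ * -Δ < 0 at hde
    linarith
  have hbx : b = (1 - β₂ - β₃) • x₁ + β₂ • x₂ + β₃ • x₃ := by
    rw [he₂, he₃] at hβ
    linear_combination (norm := module) hβ
  have hdx : d = (1 - δ₂ - δ₃) • x₁ + δ₂ • x₂ + δ₃ • x₃ := by
    rw [he₂, he₃] at hδ
    linear_combination (norm := module) hδ
  -- The remaining signs of the barycentric coordinates are forced: with a wrong sign, a vertex
  -- would be a combination of a point of `A` and points of its closure, hence in `A`.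
  have hβ₁ : 0 < 1 - β₂ - β₃ := by
    by_contra! h
    have hβ₂ : 0 < β₂ := by linarith
    refine h₂.1.2 ?_
    have := combo_mem_of_isOpen hAo hAc hb.1 h₁.1.1 h₃.1.1 (s := 1 / β₂)
      (t := -(1 - β₂ - β₃) / β₂) (r := -β₃ / β₂) (by positivity)
      (div_nonneg (by linarith) hβ₂.le) (div_nonneg (by linarith) hβ₂.le) (by field_simp; ring)
    convert this using 1
    nth_rw 1 [hbx]
    match_scalars <;> field_simp <;> ring
  have hβ₂ : 0 < β₂ := by
    by_contra! h
    refine h₁.1.2 ?_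
    set k := 1 - β₂ - β₃ with hk
    have := combo_mem_of_isOpen hAo hAc hb.1 h₂.1.1 h₃.1.1 (s := 1 / k)
      (t := -β₂ / k) (r := -β₃ / k) (by positivity)
      (div_nonneg (by linarith) hβ₁.le) (div_nonneg (by linarith) hβ₁.le)
      (by field_simp; rw [hk]; ring)
    convert this using 1
    nth_rw 1 [hbx]
    match_scalars <;> field_simp <;> ring
  have hδ₁ : 0 < 1 - δ₂ - δ₃ := by
    by_contra! h
    have hδ₃ : 0 < δ₃ := by linarith
    refine h₃.1.2 ?_
    have := combo_mem_of_isOpen hAo hAc hd.1 h₁.1.1 h₂.1.1 (s := 1 / δ₃)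
      (t := -(1 - δ₂ - δ₃) / δ₃) (r := -δ₂ / δ₃) (by positivity)
      (div_nonneg (by linarith) hδ₃.le) (div_nonneg (by linarith) hδ₃.le) (by field_simp; ring)
    convert this using 1
    nth_rw 1 [hdx]
    match_scalars <;> field_simp <;> ring
  have hpos : 0 < β₂ - δ₂ := by linarith
  -- The weights cancel the `x₂`-coordinate, so `m` is where the chord `bd` meets the line `x₁x₃`;
  -- it turns out to be strictly between these vertices.
  set l := -δ₂ / (β₂ - δ₂) with hl
  set l' := β₂ / (β₂ - δ₂) with hl'
  have hl0 : 0 < l := div_pos (by linarith) hpos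
  have hl'0 : 0 < l' := div_pos hβ₂ hpos
  have hll : l + l' = 1 := by rw [hl, hl', ← add_div, neg_add_eq_sub, div_self hpos.ne']
  have hc₂ : l * β₂ + l' * δ₂ = 0 := by rw [hl, hl']; field_simp; ring
  set c₃ := l * β₃ + l' * δ₃ with hc₃
  set m := l • b + l' • d with hm
  have hmbd : m ∈ openSegment ℝ b d := ⟨l, l', hl0, hl'0, hll, rfl⟩
  have hmx : m = (1 - c₃) • x₁ + c₃ • x₃ := by
    rw [hm, hbx, hdx, hc₃]
    have e1 : (l * (1 - β₂ - β₃) + l' * (1 - δ₂ - δ₃)) = 1 - (l * β₃ + l' * δ₃) := by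
      linear_combination hll - hc₂
    linear_combination (norm := module) e1 • x₁ + hc₂ • x₂
  have hc₁ : 0 < 1 - c₃ := by
    have : 1 - c₃ = l * (1 - β₂ - β₃) + l' * (1 - δ₂ - δ₃) := by
      rw [hc₃]; linear_combination hc₂ - hll
    rw [this]; positivity
  have hmA : m ∈ A := hAc.openSegment_subset hb.1 hd.1 hmbd
  have hc₃0 : 0 < c₃ := by
    by_contra! h
    refine h₁.1.2 ?_
    have := combo_mem_of_isOpen hAo hAc hmA h₃.1.1 h₃.1.1 (s := 1 / (1 - c₃))
      (t := -c₃ / (1 - c₃)) (r := 0) (by positivity)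
      (div_nonneg (by linarith) hc₁.le) le_rfl (by field_simp; ring)
    convert this using 1
    rw [hmx]
    match_scalars <;> field_simp <;> ring
  have hmB : m ∈ closure B := by
    rw [hmx]
    exact hBc.closure (frontier_subset_closure h₁.2) (frontier_subset_closure h₃.2) hc₁.le
      hc₃0.le (by ring)
  obtain ⟨K, hK, -, -, -, hKA, hside⟩ := exists_blocking_side hU hUc hV hVc hUV
    (reachableAvoiding_of_notMem_closure hb.1 hb.2)
    (reachableAvoiding_of_notMem_closure hd.1 hd.2)
    (fun h => hb.2 (subset_closure h)) (fun h => hd.2 (subset_closure h)) (subset_closure hb.1)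
    (subset_closure hd.1) hmbd hmB
  have hKA' : K ⊆ A := hKA.trans (union_subset subset_rfl (hAc.segment_subset hb.1 hd.1))
  -- The vertices `x₁` and `x₃` are on different sides of the line `bd`, and both are in the closure
  -- of `B`. The one on the blocked side would be in `K`, hence in `A`.
  have key : ∀ v : Plane, crossL v (d - b) = 0 → crossL v (x₃ - x₁) ≠ 0 →
      (∀ x ∈ B, 0 < crossL v (x - b) → x ∈ K) → False := by
    intro v hv hv3 hvK
    have hmb : m - b = l' • (d - b) := by
      rw [hm]; linear_combination (norm := module) hll • b
    have hm0 : crossL v (m - b) = 0 := by rw [hmb, map_smul, hv, smul_zero]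
    have e1 : x₁ - b = (m - b) - c₃ • (x₃ - x₁) := by rw [hmx]; module
    have e3 : x₃ - b = (m - b) + (1 - c₃) • (x₃ - x₁) := by rw [hmx]; module
    have f1 : crossL v (x₁ - b) = - (c₃ * crossL v (x₃ - x₁)) := by
      rw [e1, map_sub, hm0, map_smul, smul_eq_mul, zero_sub]
    have f3 : crossL v (x₃ - b) = (1 - c₃) * crossL v (x₃ - x₁) := by
      rw [e3, map_add, hm0, map_smul, smul_eq_mul, zero_add]
    rcases lt_or_gt_of_ne hv3 with h | h
    · exact h₁.1.2 (hKA' (closure_inter_halfPlane_subset hK.isClosed v b hvK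
        (frontier_subset_closure h₁.2) (by rw [f1]; exact neg_pos.2 (mul_neg_of_pos_of_neg hc₃0 h))))
    · exact h₃.1.2 (hKA' (closure_inter_halfPlane_subset hK.isClosed v b hvK
        (frontier_subset_closure h₃.2) (by rw [f3]; exact mul_pos hc₁ h)))
  have hneg : ∀ x, crossL (b - d) x = -crossL (d - b) x := fun x => by
    simp only [crossL_apply, PiLp.sub_apply]; ring
  have hdb : d - b = (δ₂ - β₂) • e₂ + (δ₃ - β₃) • e₃ := by
    linear_combination (norm := module) hδ - hβ
  have hlin : ∀ x, crossL (d - b) x = (δ₂ - β₂) * crossL e₂ x + (δ₃ - β₃) * crossL e₃ x := by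
    intro x
    rw [hdb]; simp only [crossL_apply, PiLp.add_apply, PiLp.smul_apply, smul_eq_mul]; ring
  have hne : crossL (d - b) (x₃ - x₁) ≠ 0 := by
    rw [hlin]
    change (δ₂ - β₂) * Δ + (δ₃ - β₃) * crossL e₃ e₃ ≠ 0
    rw [crossL_self, mul_zero, add_zero]
    exact mul_ne_zero (by linarith) hΔ0
  rcases hside with hs | hs
  · exact key (d - b) (crossL_self _) hne hs
  · exact key (b - d) (by rw [hneg]; simp) (by rw [hneg]; exact neg_ne_zero.2 hne)
      (fun x hx h => hs x hx (by rw [hneg] at h; linarith))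

/-- Beyond an edge of a triangle of common boundary points one of the two sets leaves the closure
of the other one, if there are only finitely many common boundary points. -/
theorem exists_beyondEdge {A B : Set Plane} (hA : IsOpen A) (hAc : Convex ℝ A) (hB : IsOpen B)
    (hBc : Convex ℝ B) (hfin : (frontier A ∩ frontier B).Finite) {x₁ x₂ x₃ : Plane}
    (h₁ : x₁ ∈ frontier A ∩ frontier B) (h₂ : x₂ ∈ frontier A ∩ frontier B)
    (h₃ : x₃ ∈ frontier A ∩ frontier B) (hΔ : crossL (x₂ - x₁) (x₃ - x₁) ≠ 0) :
    (∃ b ∈ A \ closure B, BeyondEdge x₁ x₂ x₃ b) ∨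
      ∃ b ∈ B \ closure A, BeyondEdge x₁ x₂ x₃ b := by
  by_contra! hcon
  set Δ := crossL (x₂ - x₁) (x₃ - x₁) with hΔd
  set f : Plane →L[ℝ] ℝ := (-Δ) • crossL (x₂ - x₁) with hf
  have hfx : ∀ x, f x = -Δ * crossL (x₂ - x₁) x := fun x => rfl
  have hbey : ∀ x, f x₁ < f x → BeyondEdge x₁ x₂ x₃ x := by
    intro x hx
    rw [hfx, hfx] at hx
    unfold BeyondEdge
    rw [map_sub]
    change (crossL (x₂ - x₁) x - crossL (x₂ - x₁) x₁) * Δ < 0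
    linarith
  have hf2 : f x₂ = f x₁ := by
    have := crossL_self (x₂ - x₁)
    rw [map_sub] at this
    rw [hfx, hfx, sub_eq_zero.1 this]
  have hf3 : f x₃ < f x₁ := by
    have h : crossL (x₂ - x₁) x₃ - crossL (x₂ - x₁) x₁ = Δ := by rw [← map_sub]
    have := mul_self_pos.2 hΔ
    rw [hfx, hfx, sub_eq_iff_eq_add.1 h]
    linarith
  have hf0 : f ≠ 0 := by intro h; rw [h] at hf3; simp at hf3
  have hx12 : x₁ ≠ x₂ := by rintro rfl; simp [crossL_apply, hΔd] at hΔ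
  set R := {x | f x₁ < f x} with hR
  have hRo : IsOpen R := isOpen_lt continuous_const f.continuous
  have hAB : A ∩ R ⊆ B := by
    have : A ∩ R ⊆ interior (closure B) := interior_maximal (fun x hx => by
      by_contra h; exact hcon.1 x ⟨hx.1, h⟩ (hbey x hx.2)) (hA.inter hRo)
    rwa [hB.interior_closure_of_convex hBc] at this
  have hBA : B ∩ R ⊆ A := by
    have : B ∩ R ⊆ interior (closure A) := interior_maximal (fun x hx => by
      by_contra h; exact hcon.2 x ⟨hx.1, h⟩ (hbey x hx.2)) (hB.inter hRo)
    rwa [hA.interior_closure_of_convex hAc] at this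
  -- Beyond the edge the two sets coincide. Either they have points there and share infinitely many
  -- boundary points, or the whole edge is a common boundary segment.
  by_cases hex : (A ∩ R).Nonempty
  · obtain ⟨a, haA, haR⟩ := hex
    have hRp : IsPreconnected R :=
      ((convex_Ioi (f x₁)).is_linear_preimage f.isLinear).isPreconnected
    have hyR : x₁ + (x₁ - x₃) ∈ R := by
      change f x₁ < f (x₁ + (x₁ - x₃))
      rw [map_add, map_sub]; linarith
    have hyA : x₁ + (x₁ - x₃) ∉ A := by
      intro h
      rw [hA.frontier_eq] at h₁ h₃
      refine h₁.1.2 (hA.openSegment_subset_of_mem_closure hAc h h₃.1.1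
        ⟨1 / 2, 1 / 2, by norm_num, by norm_num, by norm_num, by module⟩)
    obtain ⟨p, hpR, hpA⟩ := hRp.exists_mem_frontier (T := A) ⟨a, haR, haA⟩ ⟨_, hyR, hyA⟩
    refine infinite_frontier_inter hA hAc hRo hpA hpR (hfin.subset ?_)
    rintro q ⟨hqA, hqR⟩
    refine ⟨hqA, ?_⟩
    rw [hA.frontier_eq] at hqA
    rw [hB.frontier_eq]
    exact ⟨closure_mono hAB (hRo.closure_inter ⟨hqA.1, hqR⟩), fun h => hqA.2 (hBA ⟨h, hqR⟩)⟩
  · have hside : ∀ W : Set Plane, IsOpen W → Convex ℝ W → (∀ x ∈ W, x ∉ R) →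
        x₁ ∈ closure W → x₂ ∈ closure W → segment ℝ x₁ x₂ ⊆ frontier W := by
      intro W hW hWc hWR hw1 hw2 x hx
      rw [hW.frontier_eq]
      refine ⟨hWc.closure.segment_subset hw1 hw2 hx, fun hxW => ?_⟩
      have h1 := lt_of_isOpen_of_le hW hf0 (fun y hy => not_lt.1 (hWR y hy)) x hxW
      exact h1.ne (((convex_singleton (f x₁)).is_linear_preimage f.isLinear).segment_subset
        rfl hf2 hx)
    have hAR : ∀ x ∈ A, x ∉ R := fun x hx hxR => hex ⟨x, hx, hxR⟩
    have hBR : ∀ x ∈ B, x ∉ R := fun x hx hxR => hAR x (hBA ⟨hx, hxR⟩) hxR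
    refine (convex_segment x₁ x₂).isPreconnected.infinite_of_nontrivial
      ⟨x₁, left_mem_segment ℝ _ _, x₂, right_mem_segment ℝ _ _, hx12⟩ (hfin.subset ?_)
    exact subset_inter
      (hside A hA hAc hAR (frontier_subset_closure h₁.1) (frontier_subset_closure h₂.1))
      (hside B hB hBc hBR (frontier_subset_closure h₁.2) (frontier_subset_closure h₂.2))

/-- Three collinear common boundary points lie on common boundary segments. -/
theorem infinite_of_collinear {A B : Set Plane} (hA : IsOpen A) (hAc : Convex ℝ A) (hB : IsOpen B)
    (hBc : Convex ℝ B) {f g : Plane →L[ℝ] ℝ} {v : Plane}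
    (hg : ∀ x y, f x = f y → x = y + (g x - g y) • v) {x y z : Plane}
    (hx : x ∈ frontier A ∩ frontier B) (hy : y ∈ frontier A ∩ frontier B)
    (hz : z ∈ frontier A ∩ frontier B) (hfx : f x = f y) (hfz : f z = f y)
    (hxy : g x < g y) (hyz : g y < g z) : (frontier A ∩ frontier B).Infinite := by
  have hside : ∀ W : Set Plane, IsOpen W → Convex ℝ W → x ∈ frontier W → y ∈ frontier W →
      z ∈ frontier W → segment ℝ x y ⊆ frontier W := by
    intro W hW hWc hwx hwy hwz w hw
    rw [hW.frontier_eq] at *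
    refine ⟨hWc.closure.segment_subset hwx.1 hwy.1 hw, fun hwW => hwy.2 ?_⟩
    have hfw : f w = f y := ((convex_singleton (f y)).is_linear_preimage
      f.isLinear).segment_subset hfx rfl hw
    have hgw : g w ≤ g y := ((convex_Iic (g y)).is_linear_preimage g.isLinear).segment_subset
      hxy.le (le_refl (g y)) hw
    refine hW.openSegment_subset_of_mem_closure hWc hwW hwz.1 (mem_openSegment_of_mem_segment
      (mem_segment_of_level_coordinate hg hfw hfz hgw hyz.le) ?_ ?_)
    · rintro rfl; exact hwy.2 hwW
    · rintro rfl; exact lt_irrefl _ hyz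
  refine ((convex_segment x y).isPreconnected.infinite_of_nontrivial
    ⟨x, left_mem_segment ℝ _ _, y, right_mem_segment ℝ _ _, ?_⟩).mono
    (subset_inter (hside A hA hAc hx.1 hy.1 hz.1) (hside B hB hBc hx.2 hy.2 hz.2))
  rintro rfl; exact lt_irrefl _ hxy

/-- Collinear triples give a common segment. For a triangle, three edges are distributed among two
sets, and no set can take two of them. -/
theorem encard_frontier_inter_frontier_le {U V : Set Plane} (hU : IsOpen U)
    (hUc : IsConnected U) (hV : IsOpen V) (hVc : IsConnected V) (hUV : Disjoint U V)
    (hfin : (frontier (convexHull ℝ U) ∩ frontier (convexHull ℝ V)).Finite) :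
    (frontier (convexHull ℝ U) ∩ frontier (convexHull ℝ V)).encard ≤ 2 := by
  have hAc : Convex ℝ (convexHull ℝ U) := convex_convexHull ℝ U
  have hBc : Convex ℝ (convexHull ℝ V) := convex_convexHull ℝ V
  have hAo : IsOpen (convexHull ℝ U) := hU.convexHull
  have hBo : IsOpen (convexHull ℝ V) := hV.convexHull
  by_contra! hlt
  rw [← hfin.cast_ncard_eq] at hlt
  have hlt : 2 < (frontier (convexHull ℝ U) ∩ frontier (convexHull ℝ V)).ncard := by
    exact_mod_cast hlt
  obtain ⟨x₁, x₂, x₃, h₁, h₂, h₃, h12, h13, h23⟩ := (two_lt_ncard_iff hfin).1 hlt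
  by_cases hΔ : crossL (x₂ - x₁) (x₃ - x₁) = 0
  · have hv : x₂ - x₁ ≠ 0 := sub_ne_zero.2 h12.symm
    have hf0 : crossL (x₂ - x₁) ≠ 0 := by
      obtain ⟨e, he⟩ := exists_crossL_pos hv
      intro h; rw [h] at he; simp at he
    obtain ⟨v, g, hg⟩ := exists_level_coordinate hf0
    have hs := crossL_self (x₂ - x₁)
    set f := crossL (x₂ - x₁)
    have f2 : f x₂ = f x₁ := by rw [map_sub] at hs; linarith
    have f3 : f x₃ = f x₁ := by rw [map_sub] at hΔ; linarith
    have hgne : ∀ x y, f x = f y → x ≠ y → g x ≠ g y := by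
      intro x y h hne heq
      apply hne; rw [hg x y h, heq]; simp
    have key : ∀ x y z, x ∈ frontier (convexHull ℝ U) ∩ frontier (convexHull ℝ V) →
        y ∈ frontier (convexHull ℝ U) ∩ frontier (convexHull ℝ V) →
        z ∈ frontier (convexHull ℝ U) ∩ frontier (convexHull ℝ V) → f x = f y → f z = f y →
        g x < g y → g y < g z → False := fun x y z hx hy hz hfx hfz hxy hyz =>
      infinite_of_collinear hAo hAc hBo hBc hg hx hy hz hfx hfz hxy hyz hfin
    have f23 : f x₂ = f x₃ := f2.trans f3.symm
    rcases lt_or_gt_of_ne (hgne _ _ f2 h12.symm) with a | a <;>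
    rcases lt_or_gt_of_ne (hgne _ _ f3 h13.symm) with b | b <;>
    rcases lt_or_gt_of_ne (hgne _ _ f23 h23) with c | c
    · exact key x₂ x₃ x₁ h₂ h₃ h₁ f23 f3.symm c b
    · exact key x₃ x₂ x₁ h₃ h₂ h₁ f23.symm f2.symm c a
    · exact key x₂ x₁ x₃ h₂ h₁ h₃ f2 f3 a b
    · linarith
    · linarith
    · exact key x₃ x₁ x₂ h₃ h₁ h₂ f3 f2 b a
    · exact key x₁ x₂ x₃ h₁ h₂ h₃ f2.symm f23.symm a c
    · exact key x₁ x₃ x₂ h₁ h₃ h₂ f3.symm f23 b c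
  · have hΔ2 : crossL (x₃ - x₁) (x₂ - x₁) ≠ 0 := by
      intro h; apply hΔ; simp only [crossL_apply] at h ⊢; linarith
    have hΔ3 : crossL (x₃ - x₂) (x₁ - x₂) ≠ 0 := by
      intro h; apply hΔ; simp only [crossL_apply, PiLp.sub_apply] at h ⊢; linarith
    have E12 := exists_beyondEdge hAo hAc hBo hBc hfin h₁ h₂ h₃ hΔ
    have E13 := exists_beyondEdge hAo hAc hBo hBc hfin h₁ h₃ h₂ hΔ2
    have E23 := exists_beyondEdge hAo hAc hBo hBc hfin h₂ h₃ h₁ hΔ3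
    have TA : ∀ {x₁ x₂ x₃ b d : Plane}, _ → _ → _ → _ → _ → _ → _ → False :=
      fun {x₁ x₂ x₃ b d} h₁ h₂ h₃ hb hd =>
        not_beyondEdge_beyondEdge (x₁ := x₁) (x₂ := x₂) (x₃ := x₃) (b := b) (d := d)
          hU hUc hV hVc hUV h₁ h₂ h₃ hb hd
    have TB : ∀ {x₁ x₂ x₃ b d : Plane}, _ → _ → _ → _ → _ → _ → _ → False :=
      fun {x₁ x₂ x₃ b d} h₁ h₂ h₃ hb hd =>
        not_beyondEdge_beyondEdge (x₁ := x₁) (x₂ := x₂) (x₃ := x₃) (b := b) (d := d)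
          hV hVc hU hUc hUV.symm h₁ h₂ h₃ hb hd
    rcases E12 with ⟨b, hb, hbe⟩ | ⟨b, hb, hbe⟩ <;> rcases E13 with ⟨d, hd, hde⟩ | ⟨d, hd, hde⟩
    · exact TA h₁ h₂ h₃ hb hd hbe hde
    · rcases E23 with ⟨e, he, hee⟩ | ⟨e, he, hee⟩
      · exact TA h₂ h₁ h₃ hb he hbe.swap hee
      · exact TB h₃.symm h₁.symm h₂.symm hd he hde.swap hee.swap
    · rcases E23 with ⟨e, he, hee⟩ | ⟨e, he, hee⟩
      · exact TA h₃ h₁ h₂ hd he hde.swap hee.swap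
      · exact TB h₂.symm h₁.symm h₃.symm hb he hbe.swap hee
    · exact TB h₁.symm h₂.symm h₃.symm hb hd hbe hde

/-! ### From polygons to their interiors -/

theorem IsConvexPolygonalRegion.convex {Q : Set Plane} (h : IsConvexPolygonalRegion Q) :
    Convex ℝ Q := by
  obtain ⟨F, -, hF, rfl⟩ := h
  refine convex_sInter fun H hH => ?_
  obtain ⟨a, b, -, rfl⟩ := hF H hH
  exact (convex_Iic b).is_linear_preimage (innerSL ℝ a).isLinear

/-- The part of the open set that is left over is covered by finitely many boundaries of convex
sets, which are null sets; an open null set is empty. -/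
theorem closure_interior_sUnion_subset {F : Set (Set Plane)} (hF : F.Finite)
    (hc : ∀ Q ∈ F, Convex ℝ Q) :
    closure (interior (⋃₀ F)) ⊆ ⋃ Q ∈ F, closure (interior Q) := by
  have hcl : IsClosed (⋃ Q ∈ F, closure (interior Q)) :=
    hF.isClosed_biUnion fun _ _ => isClosed_closure
  refine closure_minimal (fun x hx => ?_) hcl
  by_contra hxn
  set G := interior (⋃₀ F) \ ⋃ Q ∈ F, closure (interior Q) with hG
  have hGo : IsOpen G := isOpen_interior.sdiff hcl
  have hsub : G ⊆ ⋃ Q ∈ F, frontier Q := by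
    rintro y ⟨hy, hyn⟩
    obtain ⟨Q, hQ, hyQ⟩ := interior_subset hy
    refine mem_biUnion hQ ⟨subset_closure hyQ, fun h => hyn ?_⟩
    exact mem_biUnion hQ (subset_closure h)
  have hnull : MeasureTheory.volume G = 0 :=
    MeasureTheory.measure_mono_null hsub ((MeasureTheory.measure_biUnion_null_iff
      hF.countable).2 fun Q hQ => (hc Q hQ).addHaar_frontier _)
  have hemp := (hGo.measure_eq_zero_iff MeasureTheory.volume).1 hnull
  exact (hemp ▸ (⟨hx, hxn⟩ : x ∈ G) : x ∈ (∅ : Set Plane))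

/-- Here polygonality is used: a point of the closure is in the closure of the interior of a single
convex piece, and is accessible within this piece. -/
theorem IsConnectedPolygon.segmentAccessible {P : Set Plane} (h : IsConnectedPolygon P) :
    SegmentAccessible (interior P) := by
  intro x hx
  obtain ⟨F, hF, hFc, rfl⟩ := h.polygonal
  obtain ⟨Q, hQ, hxQ⟩ := mem_iUnion₂.1
    (closure_interior_sUnion_subset hF (fun Q hQ => (hFc Q hQ).convex) hx)
  have hsub : interior Q ⊆ interior (⋃₀ F) := interior_mono (subset_sUnion_of_mem hQ)
  obtain ⟨u, hu⟩ := closure_nonempty_iff.1 ⟨x, hxQ⟩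
  exact ⟨u, hsub hu, ((hFc Q hQ).convex.openSegment_closure_interior_subset_interior
    (closure_mono interior_subset hxQ) hu).trans hsub⟩

theorem IsConnectedPolygon.closure_convexHull {P : Set Plane} (h : IsConnectedPolygon P) :
    closure (convexHull ℝ P) = closure (convexHull ℝ (interior P)) := by
  refine Subset.antisymm (closure_minimal ?_ isClosed_closure)
    (closure_mono (convexHull_mono interior_subset))
  have := convexHull_closure_subset (interior P)
  rwa [h.regular] at this

/-- An open convex set is the interior of its closure, and both hulls have the same closure. -/
theorem IsConnectedPolygon.interior_convexHull {P : Set Plane} (h : IsConnectedPolygon P) :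
    interior (convexHull ℝ P) = convexHull ℝ (interior P) := by
  have ho : IsOpen (convexHull ℝ (interior P)) := isOpen_interior.convexHull
  refine Subset.antisymm ?_ (interior_maximal (convexHull_mono interior_subset) ho)
  rw [← ho.interior_closure_of_convex (convex_convexHull ℝ _), ← h.closure_convexHull]
  exact interior_mono subset_closure

theorem IsConnectedPolygon.frontier_convexHull {P : Set Plane} (h : IsConnectedPolygon P) :
    frontier (convexHull ℝ P) = frontier (convexHull ℝ (interior P)) := by
  have ho : IsOpen (convexHull ℝ (interior P)) := isOpen_interior.convexHull
  rw [ho.frontier_eq, frontier, h.closure_convexHull, h.interior_convexHull]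

theorem mainTheorem9 :
    (∀ P P' : Set Plane, IsConnectedPolygon P → IsConnectedPolygon P' →
      Disjoint (interior P) (interior P') →
      (boundaryCrossings (convexHull ℝ P) (convexHull ℝ P')).encard ≤ 2) ∧
    (∀ (m : ℕ) (P : Fin m → Set Plane), (∀ i, IsConnectedPolygon (P i)) →
      (∀ i j, i ≠ j → Disjoint (interior (P i)) (interior (P j))) →
      IsConvexPseudoDiskFamily (fun i => convexHull ℝ (P i))) := by
  have hcross : ∀ P P' : Set Plane, IsConnectedPolygon P → IsConnectedPolygon P' →
      Disjoint (interior P) (interior P') →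
      (boundaryCrossings (convexHull ℝ P) (convexHull ℝ P')).encard ≤ 2 := fun P P' h h' hd =>
    encard_boundaryCrossings_le isOpen_interior h.connected isOpen_interior h'.connected hd
      h.frontier_convexHull h'.frontier_convexHull h'.interior_convexHull h'.closure_convexHull
  refine ⟨hcross, fun m P hP hdis => ⟨fun i => convex_convexHull ℝ _, fun i => ?_,
    fun i j hij => hcross _ _ (hP i) (hP j) (hdis i j hij), fun i j hij hfin => ?_,
    fun i j hij => ?_⟩⟩
  · have hne : (convexHull ℝ (P i)).Nonempty :=
      ((hP i).connected.nonempty.mono interior_subset).convexHull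
    have := (convex_convexHull ℝ (P i)).contractibleSpace hne
    infer_instance
  · simp only [(hP i).frontier_convexHull, (hP j).frontier_convexHull] at hfin ⊢
    exact encard_frontier_inter_frontier_le isOpen_interior (hP i).connected isOpen_interior
      (hP j).connected (hdis i j hij) hfin
  · have := isPreconnected_hull_diff_hull isOpen_interior (hP i).connected isOpen_interior
      (hP j).connected (hdis i j hij) (hP i).segmentAccessible (hP j).segmentAccessible
    rwa [(hP i).regular, (hP j).regular] at this
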